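/- Let $N\ge 2$ and let $\Omega\subset\mathbb R^N$ be an open ball $\{|x|<R\}$ ($R>0$) or an open annulus $\{a<|x|<b\}$ ($0<a<b$) centered at the origin. Let $f,g:\Omega\times\mathbb R\to\mathbb R$ be Carathéodory functions such that $f(\cdot,t)$ and $g(\cdot,t)$ are radial for every $t\in\mathbb R$, and such that $h=f$ and $h=g$ each satisfy the following two conditions: (i) there are $C>0$ and $r>1$, with $r<2N/(N-2)$ if $N\ge 3$, such that $|h(x,t)|\le C(|t|^{r-1}+1)$ for a.e. $x\in\Omega$ and all $t\in\mathbb R$; (ii) for every $M>0$ there is $C_M>0$ such that $|h(x,s)-h(x,t)|\le C_M|s-t|$ for a.e. $x\in\Omega$ and all $s,t\in[-M,M]$. Put $F(x,t)=\int_0^t f(x,s)\,ds$, $G(x,t)=\int_0^t g(x,s)\,ds$, $$\Phi(u)=\int_\Omega \tfrac12|\nabla u|^2-F(x,u),\quad u\in H^1_0(\Omega),\qquad \mathcal M=\Big\{u\in H^1_0(\Omega):\int_\Omega G(x,u)=1\Big\}.$$ Let $u_0\in C^2(\Omega)\cap C(\overline\Omega)$ belong to $\mathcal M$ and minimize $\Phi$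 on $\mathcal M$, and assume that either $g(x,u_0(x))>0$ for a.e. $x\in\Omega$, or $g(x,u_0(x))<0$ for a.e. $x\in\Omega$. Then there is exactly one $\lambda\in\mathbb R$ (the Lagrange multiplier) such that $-\Delta u_0=f(x,u_0)+\lambda\,g(x,u_0)$ a.e. in $\Omega$, and for this $\lambda$ the following hold. (a) If $t\mapsto f(x,t)+\lambda g(x,t)$ is strictly convex on $\mathbb R$ for a.e. $x\in\Omega$, then $u_0$ is axially symmetric, that is, there are a unit vector $\xi\in\mathbb R^N$ and a function $\eta:\mathbb R\times\mathbb R\to\mathbb R$ such that $u_0(x)=\eta(|x|,x\cdot\xi)$ for all $x\in\Omega$. (b) If $u_0\ge 0$ in $\Omega$, the same conclusion holds when $t\mapsto f(x,t)+\lambda g(x,t)$ is only assumed to be strictly convex on $[0,\infty)$ for a.e. $x\in\Omega$. -/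

import Mathlib

open MeasureTheory Filter Topology Set
open scoped ContDiff

noncomputable section

namespace ConstrainedSymmetry

/-- Euclidean space of dimension `N`. -/
abbrev E (N : ℕ) : Type := EuclideanSpace ℝ (Fin N)

/-- `Ω` is an open ball or an open annulus centered at the origin. -/
def IsBallOrAnnulus {N : ℕ} (Ω : Set (E N)) : Prop :=
  (∃ R : ℝ, 0 < R ∧ Ω = {x | ‖x‖ < R}) ∨
    ∃ a b : ℝ, 0 < a ∧ a < b ∧ Ω = {x | a < ‖x‖ ∧ ‖x‖ < b}

/-- Smooth functions with compact support in `Ω`. -/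
def IsTestFunction {N : ℕ} (Ω : Set (E N)) (φ : E N → ℝ) : Prop :=
  ContDiff ℝ ∞ φ ∧ HasCompactSupport φ ∧ tsupport φ ⊆ Ω

/-- `V` is a weak gradient of `u` on `Ω`. -/
def HasWeakGradient {N : ℕ} (Ω : Set (E N)) (u : E N → ℝ) (V : E N → E N) : Prop :=
  LocallyIntegrableOn u Ω ∧ LocallyIntegrableOn V Ω ∧
    ∀ φ : E N → ℝ, IsTestFunction Ω φ → ∀ e : E N,
      ∫ x in Ω, u x * fderiv ℝ φ x e = -∫ x in Ω, inner ℝ (V x) e * φ x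

open Classical in
/-- The weak gradient (unique up to null sets on an open set; zero if there is none). -/
def weakGradient {N : ℕ} (Ω : Set (E N)) (u : E N → ℝ) : E N → E N :=
  if h : ∃ V, HasWeakGradient Ω u V then h.choose else 0

/-- Membership of (the class of) `u` in `H^1_0(Ω)`, the closure of the test functions in
`H^1(Ω)`. Only the values of `u` on `Ω` matter. -/
def MemH10 {N : ℕ} (Ω : Set (E N)) (u : E N → ℝ) : Prop :=
  MemLp u 2 (volume.restrict Ω) ∧
    ∃ V : E N → E N, HasWeakGradient Ω u V ∧ MemLp V 2 (volume.restrict Ω) ∧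
      ∃ φ : ℕ → E N → ℝ, (∀ n, IsTestFunction Ω (φ n)) ∧
        Tendsto (fun n => eLpNorm (fun x => φ n x - u x) 2 (volume.restrict Ω)) atTop (𝓝 0) ∧
        Tendsto (fun n => eLpNorm (fun x => gradient (φ n) x - V x) 2 (volume.restrict Ω))
          atTop (𝓝 0)

/-- Carathéodory functions on `Ω × ℝ`. -/
def IsCaratheodory {N : ℕ} (Ω : Set (E N)) (f : E N → ℝ → ℝ) : Prop :=
  (∀ t : ℝ, AEMeasurable (fun x => f x t) (volume.restrict Ω)) ∧
    ∀ᵐ x ∂volume.restrict Ω, Continuous (f x)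

/-- `f(·, t)` is radial on `Ω` for every `t`. -/
def IsRadial {N : ℕ} (Ω : Set (E N)) (f : E N → ℝ → ℝ) : Prop :=
  ∀ t : ℝ, ∀ x ∈ Ω, ∀ y ∈ Ω, ‖x‖ = ‖y‖ → f x t = f y t

/-- The subcritical growth condition. -/
def SubcriticalGrowth {N : ℕ} (Ω : Set (E N)) (f : E N → ℝ → ℝ) : Prop :=
  ∃ C r : ℝ, 0 < C ∧ 1 < r ∧ (3 ≤ N → r < 2 * (N : ℝ) / ((N : ℝ) - 2)) ∧
    ∀ᵐ x ∂volume.restrict Ω, ∀ t : ℝ, |f x t| ≤ C * (|t| ^ (r - 1) + 1)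

/-- Local Lipschitz continuity in the second variable, uniformly in the first one. -/
def LocLipschitzInSecond {N : ℕ} (Ω : Set (E N)) (f : E N → ℝ → ℝ) : Prop :=
  ∀ M : ℝ, 0 < M → ∃ C : ℝ, 0 < C ∧
    ∀ᵐ x ∂volume.restrict Ω, ∀ s ∈ Icc (-M) M, ∀ t ∈ Icc (-M) M,
      |f x s - f x t| ≤ C * |s - t|

/-- `F(x, t) = ∫₀ᵗ f(x, s) ds`. -/
def primitive {N : ℕ} (f : E N → ℝ → ℝ) (x : E N) (t : ℝ) : ℝ := ∫ s in (0 : ℝ)..t, f x s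

/-- The functional `Φ(u) = ∫_Ω ½ |∇u|² - F(x, u)`. -/
def energy {N : ℕ} (Ω : Set (E N)) (f : E N → ℝ → ℝ) (u : E N → ℝ) : ℝ :=
  ∫ x in Ω, ((1 / 2 : ℝ) * ‖weakGradient Ω u x‖ ^ 2 - primitive f x (u x))

/-- The constraint set `{u ∈ H^1_0(Ω) : ∫_Ω G(x, u) = 1}`. -/
def constraintSet {N : ℕ} (Ω : Set (E N)) (g : E N → ℝ → ℝ) : Set (E N → ℝ) :=
  {u | MemH10 Ω u ∧ ∫ x in Ω, primitive g x (u x) = 1}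

/-- `-Δ u = f(x, u) + lam g(x, u)` almost everywhere in `Ω`, for `u` of class `C²` on `Ω`. -/
def SolvesWithMultiplier {N : ℕ} (Ω : Set (E N)) (f g : E N → ℝ → ℝ) (u : E N → ℝ)
    (lam : ℝ) : Prop :=
  ∀ᵐ x ∂volume.restrict Ω, -(Laplacian.laplacian u x) = f x (u x) + lam * g x (u x)

/-- Symmetry of `u` about a line `ℝ ξ` through the origin: on `Ω`, the value `u x` depends only
on `‖x‖` and on the component of `x` along `ξ`. -/
def IsAxiallySymmetric {N : ℕ} (Ω : Set (E N)) (u : E N → ℝ) : Prop :=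
  ∃ ξ : E N, ‖ξ‖ = 1 ∧ ∃ η : ℝ → ℝ → ℝ, ∀ x ∈ Ω, u x = η ‖x‖ (inner ℝ x ξ)

end ConstrainedSymmetry

end

noncomputable section

namespace ConstrainedSymmetry


/-! ### Convergence in L² -/

section LTwo

variable {α F : Type*} [MeasurableSpace α] {μ : Measure α} [NormedAddCommGroup F]

/-! Write `u` for the minimizer, `h = f + lam * g`, `H` for the primitive of `h`, and `E_h` for the
energy built on `h`. On the constraint set `E_h` differs from the original energy by the constant
`lam`, so `u` minimizes `E_h` there as well.

Fix a reflection `σ` in a hyperplane through the origin with normal `e`, and let `z` be the positive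
part of `u - u ∘ σ` on the half-space of `e`, extended by zero. Testing the weak equation with `z`
and `z ∘ σ`, and using that `h` is radial, gives `∫ |∇z|² = ∫ (h(x, u) - h(x, u ∘ σ)) z`. Hence
`E_h(u + t z) - E_h(u)` is minus the integral of `H(x, u + t z) - H(x, u) - t h(x, u) z - t²/2 (h(x,
u) - h(x, u ∘ σ)) z`. Where `z ≠ 0`, this integrand is the integral, from `u` to `u + t z`, of `h(x,
·)` minus its chord through the abscissae `u ∘ σ` and `u`. Convexity puts the chord above the graph
between the two points and below it to the right of `u`, so the integrand is nonnegative for `t ≥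
-1`, and positive for `t > 0`. This is `energy_add_excess`.

Let `z₁`, `z₂` be these functions for `e` and `-e`. If neither vanished, then, since `g(x, u)` has a
strict sign, small `t, s > 0` could be chosen so that `u + t z₁ - s z₂` still satisfies the
constraint. As `z₁` and `z₂` live on opposite sides, the energy changes add up; the first is
negative and the second nonpositive, which contradicts minimality (`not_exists_lt_both_sides`). So
for each hyperplane, `u` is dominated by its reflection on one of the two sides.

Now take `e` orthogonal to the first moment `m = ∫ u(x) x dx`. The function `(u ∘ σ - u) ⟨x, e⟩`
then has one sign and integral zero, so `u = u ∘ σ` (`comp_reflection_eq_of_one_sided`). Reflections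
in such hyperplanes join any two points with equal norm and equal component along `m`, and axial
symmetry follows.

Two preliminaries carry the rest. The Lagrange multiplier (`exists_multiplier`) comes from a direct
two-parameter perturbation. The membership of `z` in `H^1_0`, with the expected gradient
(`sobolevPair_excess`), comes from smoothing the positive part. Since `u` is bounded, `f` and `g`
are only needed on bounded ranges, where they are bounded and Lipschitz. -/

theorem tendsto_eLpNorm_two_of_dominated {f : ℕ → α → F} {g : α → F} {b : α → ℝ}
    (hf : ∀ n, AEStronglyMeasurable (f n) μ) (hg : AEStronglyMeasurable g μ)
    (hb : MemLp b 2 μ) (hle : ∀ n, ∀ᵐ x ∂μ, ‖f n x - g x‖ ≤ b x)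
    (hlim : ∀ᵐ x ∂μ, Tendsto (fun n => f n x) atTop (𝓝 (g x))) :
    Tendsto (fun n => eLpNorm (fun x => f n x - g x) 2 μ) atTop (𝓝 0) := by
  have key : Tendsto (fun n => ∫⁻ x, ‖f n x - g x‖ₑ ^ (2 : ℝ) ∂μ) atTop (𝓝 (∫⁻ _, 0 ∂μ)) := by
    refine tendsto_lintegral_of_dominated_convergence' (fun x => ‖b x‖ₑ ^ (2 : ℝ))
      (fun n => (((hf n).sub hg).enorm).pow_const _) (fun n => ?_) ?_ ?_
    · filter_upwards [hle n] with x hx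
      gcongr
      exact enorm_le_iff_norm_le.2 (hx.trans (le_abs_self _))
    · have h := hb.eLpNorm_lt_top
      rw [eLpNorm_eq_lintegral_rpow_enorm_toReal (by norm_num) (by norm_num)] at h
      have := (ENNReal.rpow_lt_top_iff_of_pos (by norm_num)).1 h
      simpa using this.ne
    · filter_upwards [hlim] with x hx
      have h1 : Tendsto (fun n => ‖f n x - g x‖ₑ) atTop (𝓝 0) := by
        have : Tendsto (fun n => f n x - g x) atTop (𝓝 0) := by
          simpa using hx.sub_const (g x)
        simpa using this.enorm
      have := (ENNReal.continuous_rpow_const (y := 2)).tendsto 0 |>.comp h1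
      simpa [Function.comp_def] using this
  simp only [lintegral_zero] at key
  have := (ENNReal.continuous_rpow_const (y := 1 / 2)).tendsto 0 |>.comp key
  rw [ENNReal.zero_rpow_of_pos (by norm_num)] at this
  refine this.congr fun n => ?_
  rw [eLpNorm_eq_lintegral_rpow_enorm_toReal (by norm_num) (by norm_num)]
  simp

theorem tendsto_integral_inner_of_eLpNorm [InnerProductSpace ℝ F] {f : ℕ → α → F}
    {g k : α → F} (hf : ∀ n, MemLp (f n) 2 μ) (hg : MemLp g 2 μ) (hk : MemLp k 2 μ)
    (h : Tendsto (fun n => eLpNorm (fun x => f n x - g x) 2 μ) atTop (𝓝 0)) :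
    Tendsto (fun n => ∫ x, inner ℝ (f n x) (k x) ∂μ) atTop (𝓝 (∫ x, inner ℝ (g x) (k x) ∂μ)) := by
  have h1 := (Lp.tendsto_Lp_iff_tendsto_eLpNorm'' f hf g hg).2 h
  have h2 : ∀ f' : α → F, ∀ hf' : MemLp f' 2 μ,
      inner ℝ (hf'.toLp f') (hk.toLp k) = ∫ x, inner ℝ (f' x) (k x) ∂μ := by
    intro f' hf'
    rw [L2.inner_def]
    refine integral_congr_ae ?_
    filter_upwards [hf'.coeFn_toLp, hk.coeFn_toLp] with x hx hy
    rw [hx, hy]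
  have h3 := h1.inner (𝕜 := ℝ) (tendsto_const_nhds (x := hk.toLp k))
  simpa only [h2] using h3

theorem tendsto_integral_mul_of_eLpNorm {f : ℕ → α → ℝ}
    {g k : α → ℝ} (hf : ∀ n, MemLp (f n) 2 μ) (hg : MemLp g 2 μ) (hk : MemLp k 2 μ)
    (h : Tendsto (fun n => eLpNorm (fun x => f n x - g x) 2 μ) atTop (𝓝 0)) :
    Tendsto (fun n => ∫ x, f n x * k x ∂μ) atTop (𝓝 (∫ x, g x * k x ∂μ)) := by
  simpa [mul_comm] using tendsto_integral_inner_of_eLpNorm hf hg hk h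

theorem tendsto_eLpNorm_add {f f' : ℕ → α → F} {g g' : α → F}
    (hf : ∀ n, MemLp (f n) 2 μ) (hg : MemLp g 2 μ) (hf' : ∀ n, MemLp (f' n) 2 μ)
    (hg' : MemLp g' 2 μ)
    (h : Tendsto (fun n => eLpNorm (fun x => f n x - g x) 2 μ) atTop (𝓝 0))
    (h' : Tendsto (fun n => eLpNorm (fun x => f' n x - g' x) 2 μ) atTop (𝓝 0)) :
    Tendsto (fun n => eLpNorm (fun x => (f n x + f' n x) - (g x + g' x)) 2 μ) atTop (𝓝 0) := by
  have h0 := h.add h'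
  rw [add_zero] at h0
  refine tendsto_of_tendsto_of_tendsto_of_le_of_le tendsto_const_nhds h0 (fun _ => zero_le)
    fun n => ?_
  have := eLpNorm_add_le ((hf n).1.sub hg.1) ((hf' n).1.sub hg'.1) (p := 2) (by norm_num)
  refine le_trans (le_of_eq ?_) this
  congr 1
  ext x
  simp only [Pi.add_apply, Pi.sub_apply]
  abel

theorem tendsto_eLpNorm_const_smul [NormedSpace ℝ F] {f : ℕ → α → F} {g : α → F} (c : ℝ)
    (h : Tendsto (fun n => eLpNorm (fun x => f n x - g x) 2 μ) atTop (𝓝 0)) :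
    Tendsto (fun n => eLpNorm (fun x => c • f n x - c • g x) 2 μ) atTop (𝓝 0) := by
  have h0 := ENNReal.Tendsto.const_mul (a := ‖c‖ₑ) h (Or.inr enorm_ne_top)
  rw [mul_zero] at h0
  refine h0.congr fun n => ?_
  rw [← eLpNorm_const_smul]
  congr 1
  ext x
  simp [smul_sub]

end LTwo

/-! ### Calculus of test functions and integration by parts -/

section TestFunctions

variable {N : ℕ} {Ω : Set (E N)} {φ ψ : E N → ℝ}

theorem IsTestFunction.differentiable (h : IsTestFunction Ω φ) : Differentiable ℝ φ :=
  h.1.differentiable (by simp)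

theorem IsTestFunction.contDiff_fderiv (h : IsTestFunction Ω φ) : ContDiff ℝ ∞ (fderiv ℝ φ) :=
  h.1.fderiv_right (by simp)

theorem continuous_gradient (h : IsTestFunction Ω φ) : Continuous (gradient φ) :=
  (InnerProductSpace.toDual ℝ (E N)).symm.continuous.comp h.contDiff_fderiv.continuous

theorem hasCompactSupport_gradient (h : IsTestFunction Ω φ) : HasCompactSupport (gradient φ) :=
  (h.2.1.fderiv (𝕜 := ℝ)).comp_left (g := (InnerProductSpace.toDual ℝ (E N)).symm) (map_zero _)

theorem IsTestFunction.memLp (h : IsTestFunction Ω φ) : MemLp φ 2 (volume.restrict Ω) :=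
  (h.1.continuous.memLp_of_hasCompactSupport h.2.1).restrict _

theorem IsTestFunction.memLp_gradient (h : IsTestFunction Ω φ) :
    MemLp (gradient φ) 2 (volume.restrict Ω) :=
  ((continuous_gradient h).memLp_of_hasCompactSupport (hasCompactSupport_gradient h)).restrict _

theorem IsTestFunction.fderiv_apply (h : IsTestFunction Ω φ) (e : E N) :
    IsTestFunction Ω (fun x => fderiv ℝ φ x e) := by
  refine ⟨h.contDiff_fderiv.clm_apply contDiff_const, ?_, ?_⟩
  · exact (h.2.1.fderiv (𝕜 := ℝ)).comp_left (g := fun L : E N →L[ℝ] ℝ => L e) (by simp)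
  · refine (closure_mono ?_).trans ((tsupport_fderiv_subset ℝ).trans h.2.2)
    intro x hx
    simp only [Function.mem_support] at hx ⊢
    intro h0
    simp [h0] at hx

theorem IsTestFunction.add (h : IsTestFunction Ω φ) (h' : IsTestFunction Ω ψ) :
    IsTestFunction Ω (fun x => φ x + ψ x) :=
  ⟨h.1.add h'.1, h.2.1.add h'.2.1,
    (tsupport_add φ ψ).trans (union_subset h.2.2 h'.2.2)⟩

theorem IsTestFunction.const_mul (h : IsTestFunction Ω φ) (c : ℝ) :
    IsTestFunction Ω (fun x => c * φ x) :=
  ⟨contDiff_const.mul h.1, h.2.1.mul_left,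
    (tsupport_mul_subset_right (f := fun _ => c) (g := φ)).trans h.2.2⟩

theorem IsTestFunction.comp_isometry (h : IsTestFunction Ω φ) (L : E N ≃ₗᵢ[ℝ] E N)
    (hL : ∀ x, L x ∈ Ω ↔ x ∈ Ω) : IsTestFunction Ω (fun x => φ (L x)) := by
  refine ⟨h.1.comp L.contDiff, h.2.1.comp_homeomorph L.toHomeomorph, ?_⟩
  intro x hx
  have : tsupport (fun x => φ (L x)) ⊆ L ⁻¹' tsupport φ :=
    tsupport_comp_subset_preimage φ L.continuous
  exact (hL x).1 (h.2.2 (this hx))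

theorem gradient_comp_isometry (h : Differentiable ℝ φ) (L : E N ≃ₗᵢ[ℝ] E N) (x : E N) :
    gradient (fun x => φ (L x)) x = L.symm (gradient φ (L x)) := by
  refine ext_inner_right ℝ fun y => ?_
  rw [inner_gradient_left]
  have h1 : HasFDerivAt (fun x => φ (L x)) ((fderiv ℝ φ (L x)).comp (L : E N →L[ℝ] E N)) x :=
    (h (L x)).hasFDerivAt.comp x (L : E N →L[ℝ] E N).hasFDerivAt
  rw [h1.fderiv, ← L.inner_map_map, L.apply_symm_apply, inner_gradient_left]
  rfl

theorem gradient_add (h : Differentiable ℝ φ) (h' : Differentiable ℝ ψ) (x : E N) :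
    gradient (fun x => φ x + ψ x) x = gradient φ x + gradient ψ x := by
  refine ext_inner_right ℝ fun y => ?_
  rw [inner_add_left, inner_gradient_left, inner_gradient_left, inner_gradient_left,
    fderiv_fun_add (h x) (h' x)]
  rfl

theorem gradient_const_mul (h : Differentiable ℝ φ) (c : ℝ) (x : E N) :
    gradient (fun x => c * φ x) x = c • gradient φ x := by
  refine ext_inner_right ℝ fun y => ?_
  rw [inner_smul_left, inner_gradient_left, inner_gradient_left, fderiv_const_mul (h x)]
  rfl

theorem integral_fderiv_eq_zero_of_hasCompactSupport {w : E N → ℝ} (hw : ContDiff ℝ 1 w)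
    (hc : HasCompactSupport w) (e : E N) : ∫ x, fderiv ℝ w x e = 0 := by
  have hd : Continuous (fun x => fderiv ℝ w x e) :=
    (hw.continuous_fderiv (by simp)).clm_apply continuous_const
  have hdc : HasCompactSupport (fun x => fderiv ℝ w x e) :=
    (hc.fderiv (𝕜 := ℝ)).comp_left (g := fun L : E N →L[ℝ] ℝ => L e) (by simp)
  have := integral_mul_fderiv_eq_neg_fderiv_mul_of_integrable (𝕜 := ℝ) (μ := (volume : Measure (E N)))
    (f := fun _ => (1 : ℝ)) (g := w) (v := e) (by simp)
    (by simpa using hd.integrable_of_hasCompactSupport hdc)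
    (by simpa using hw.continuous.integrable_of_hasCompactSupport hc)
    (fun x _ => differentiableAt_const _) (fun x _ => hw.differentiable (by simp) x)
  simpa using this

theorem setIntegral_eq_integral_of_tsupport {k : E N → ℝ} (hk : ∀ x, x ∉ Ω → k x = 0) :
    ∫ x in Ω, k x = ∫ x, k x :=
  setIntegral_eq_integral_of_forall_compl_eq_zero hk

theorem IsTestFunction.eq_zero (h : IsTestFunction Ω φ) {x : E N} (hx : x ∉ Ω) : φ x = 0 :=
  image_eq_zero_of_notMem_tsupport fun h' => hx (h.2.2 h')

/-- `v` is arbitrary outside `Ω`, but the product vanishes near every point off `tsupport φ`. This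
makes integration by parts on the whole space available for functions that are regular only inside
`Ω`. -/
theorem contDiff_mul_test {n : WithTop ℕ∞} (hn : n ≤ ∞) (hΩ : IsOpen Ω) {v : E N → ℝ}
    (hv : ContDiffOn ℝ n v Ω) (h : IsTestFunction Ω φ) : ContDiff ℝ n (fun x => v x * φ x) := by
  rw [contDiff_iff_contDiffAt]
  intro x
  by_cases hx : x ∈ tsupport φ
  · exact (hv.contDiffAt (hΩ.mem_nhds (h.2.2 hx))).mul (h.1.of_le hn).contDiffAt
  · have h0 : (fun x => v x * φ x) =ᶠ[𝓝 x] fun _ => 0 := by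
      filter_upwards [notMem_tsupport_iff_eventuallyEq.1 hx] with y hy
      simp [hy]
    exact contDiffAt_const.congr_of_eventuallyEq h0

theorem integrable_mul_test (hΩ : IsOpen Ω) {v : E N → ℝ}
    (hv : ContinuousOn v Ω) (h : IsTestFunction Ω φ) :
    Integrable (fun x => v x * φ x) volume := by
  have := contDiff_mul_test (n := 0) (by simp) hΩ (contDiffOn_zero.2 hv) h
  exact this.continuous.integrable_of_hasCompactSupport h.2.1.mul_left

theorem integral_mul_fderiv_test (hΩ : IsOpen Ω) {v : E N → ℝ} (hv : ContDiffOn ℝ 1 v Ω)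
    (h : IsTestFunction Ω φ) (e : E N) :
    ∫ x in Ω, v x * fderiv ℝ φ x e = -∫ x in Ω, fderiv ℝ v x e * φ x := by
  have hdv : ContinuousOn (fun x => fderiv ℝ v x e) Ω :=
    (hv.continuousOn_fderiv_of_isOpen hΩ le_rfl).clm_apply continuousOn_const
  have h1 := integral_fderiv_eq_zero_of_hasCompactSupport
    (contDiff_mul_test (by simp) hΩ hv h) h.2.1.mul_left e
  have h2 : ∀ x, fderiv ℝ (fun x => v x * φ x) x e = v x * fderiv ℝ φ x e + fderiv ℝ v x e * φ x := by
    intro x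
    by_cases hx : x ∈ tsupport φ
    · have hd : DifferentiableAt ℝ v x :=
        (hv.contDiffAt (hΩ.mem_nhds (h.2.2 hx))).differentiableAt (by simp)
      rw [fderiv_fun_mul hd (h.differentiable x)]
      simp [mul_comm]
    · have h0 : (fun x => v x * φ x) =ᶠ[𝓝 x] fun _ => 0 := by
        filter_upwards [notMem_tsupport_iff_eventuallyEq.1 hx] with y hy
        simp [hy]
      have h3 : fderiv ℝ φ x = 0 := by
        rw [(notMem_tsupport_iff_eventuallyEq.1 hx).fderiv_eq]
        simp
      rw [h0.fderiv_eq, h3, image_eq_zero_of_notMem_tsupport hx]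
      simp
  simp_rw [h2] at h1
  rw [integral_add (integrable_mul_test hΩ hv.continuousOn (h.fderiv_apply e))
    (integrable_mul_test hΩ hdv h)] at h1
  rw [setIntegral_eq_integral_of_tsupport, setIntegral_eq_integral_of_tsupport]
  · linarith
  · intro x hx; simp [h.eq_zero hx]
  · intro x hx; simp [(h.fderiv_apply e).eq_zero hx]

end TestFunctions


/-! ### The space H¹₀ as L² limits of test functions with their gradients -/

section SobolevPairs

variable {N : ℕ} {Ω : Set (E N)}

/-- `(u, V)` is the limit in `L²` of pairs `(φ, ∇φ)` with `φ` a test function. -/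
structure SobolevPair (Ω : Set (E N)) (u : E N → ℝ) (V : E N → E N) : Prop where
  memLp : MemLp u 2 (volume.restrict Ω)
  memLp_grad : MemLp V 2 (volume.restrict Ω)
  approx : ∃ φ : ℕ → E N → ℝ, (∀ n, IsTestFunction Ω (φ n)) ∧
    Tendsto (fun n => eLpNorm (fun x => φ n x - u x) 2 (volume.restrict Ω)) atTop (𝓝 0) ∧
    Tendsto (fun n => eLpNorm (fun x => gradient (φ n) x - V x) 2 (volume.restrict Ω))
      atTop (𝓝 0)

theorem MemH10.exists_pair {u : E N → ℝ} (h : MemH10 Ω u) : ∃ V, SobolevPair Ω u V := by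
  obtain ⟨h1, V, -, h2, h3⟩ := h
  exact ⟨V, h1, h2, h3⟩

theorem IsTestFunction.sobolevPair {φ : E N → ℝ} (h : IsTestFunction Ω φ) :
    SobolevPair Ω φ (gradient φ) :=
  ⟨h.memLp, h.memLp_gradient, fun _ => φ, fun _ => h, by simp, by simp⟩

theorem SobolevPair.add {u v : E N → ℝ} {U V : E N → E N} (hu : SobolevPair Ω u U)
    (hv : SobolevPair Ω v V) : SobolevPair Ω (fun x => u x + v x) (fun x => U x + V x) := by
  obtain ⟨φ, h1, h2, h3⟩ := hu.approx
  obtain ⟨ψ, k1, k2, k3⟩ := hv.approx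
  refine ⟨hu.memLp.add hv.memLp, hu.memLp_grad.add hv.memLp_grad, fun n x => φ n x + ψ n x,
    fun n => (h1 n).add (k1 n),
    tendsto_eLpNorm_add (fun n => (h1 n).memLp) hu.memLp (fun n => (k1 n).memLp) hv.memLp h2 k2, ?_⟩
  simp_rw [fun n => gradient_add (h1 n).differentiable (k1 n).differentiable]
  exact tendsto_eLpNorm_add (fun n => (h1 n).memLp_gradient) hu.memLp_grad
    (fun n => (k1 n).memLp_gradient) hv.memLp_grad h3 k3

theorem SobolevPair.const_mul {u : E N → ℝ} {U : E N → E N} (hu : SobolevPair Ω u U) (c : ℝ) :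
    SobolevPair Ω (fun x => c * u x) (fun x => c • U x) := by
  obtain ⟨φ, h1, h2, h3⟩ := hu.approx
  refine ⟨hu.memLp.const_mul c, hu.memLp_grad.const_smul c, fun n x => c * φ n x,
    fun n => (h1 n).const_mul c, tendsto_eLpNorm_const_smul c h2, ?_⟩
  simp_rw [fun n => gradient_const_mul (h1 n).differentiable c]
  exact tendsto_eLpNorm_const_smul c h3

theorem measurePreserving_restrict (L : E N ≃ₗᵢ[ℝ] E N) (hL : ∀ x, L x ∈ Ω ↔ x ∈ Ω) :
    MeasurePreserving L (volume.restrict Ω) (volume.restrict Ω) := by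
  have h := L.measurePreserving.restrict_preimage_emb L.toHomeomorph.measurableEmbedding Ω
  rwa [show L ⁻¹' Ω = Ω from Set.ext hL] at h

theorem integral_comp_isometry {F : Type*} [NormedAddCommGroup F] [NormedSpace ℝ F]
    (L : E N ≃ₗᵢ[ℝ] E N) (hL : ∀ x, L x ∈ Ω ↔ x ∈ Ω)
    (k : E N → F) : ∫ x in Ω, k (L x) = ∫ x in Ω, k x :=
  (measurePreserving_restrict L hL).integral_comp L.toHomeomorph.measurableEmbedding k

theorem SobolevPair.comp_isometry {u : E N → ℝ} {U : E N → E N} (hu : SobolevPair Ω u U)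
    (L : E N ≃ₗᵢ[ℝ] E N) (hL : ∀ x, L x ∈ Ω ↔ x ∈ Ω) :
    SobolevPair Ω (fun x => u (L x)) (fun x => L.symm (U (L x))) := by
  obtain ⟨φ, h1, h2, h3⟩ := hu.approx
  have hP := measurePreserving_restrict L hL
  have hc : ∀ {V : E N → E N}, MemLp V 2 (volume.restrict Ω) →
      MemLp (fun x => L.symm (V (L x))) 2 (volume.restrict Ω) := fun {V} hV =>
    (hV.comp_measurePreserving hP).continuousLinearMap_comp (L.symm : E N →L[ℝ] E N)
  refine ⟨hu.memLp.comp_measurePreserving hP, hc hu.memLp_grad, fun n x => φ n (L x),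
    fun n => (h1 n).comp_isometry L hL, ?_, ?_⟩
  · refine h2.congr fun n => ?_
    exact (eLpNorm_comp_measurePreserving ((h1 n).memLp.1.sub hu.memLp.1) hP).symm
  · simp_rw [fun n => gradient_comp_isometry (h1 n).differentiable L]
    refine h3.congr fun n => ?_
    refine (eLpNorm_comp_measurePreserving ((h1 n).memLp_gradient.1.sub hu.memLp_grad.1)
      hP).symm.trans ?_
    refine eLpNorm_congr_norm_ae (ae_of_all _ fun x => ?_)
    rw [← map_sub, L.symm.norm_map]
    rfl

/-- Both sides of the defining identity are L² pairings with a fixed function, so the identity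
passes to the limit from the approximating test functions. -/
theorem SobolevPair.hasWeakGradient {u : E N → ℝ} {U : E N → E N}
    (hΩ : IsOpen Ω) (hu : SobolevPair Ω u U) : HasWeakGradient Ω u U := by
  refine ⟨?_, ?_, ?_⟩
  · exact locallyIntegrableOn_of_locallyIntegrable_restrict
      (hu.memLp.locallyIntegrable (by norm_num))
  · exact locallyIntegrableOn_of_locallyIntegrable_restrict
      (hu.memLp_grad.locallyIntegrable (by norm_num))
  intro φ hφ e
  obtain ⟨ψ, h1, h2, h3⟩ := hu.approx
  have l1 := tendsto_integral_mul_of_eLpNorm (fun n => (h1 n).memLp) hu.memLp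
    (hφ.fderiv_apply e).memLp h2
  have hk : MemLp (fun x => φ x • e) 2 (volume.restrict Ω) :=
    (ContinuousLinearMap.smulRight (1 : ℝ →L[ℝ] ℝ) e).comp_memLp' hφ.memLp
  have l2 := tendsto_integral_inner_of_eLpNorm (fun n => (h1 n).memLp_gradient) hu.memLp_grad
    hk h3
  refine tendsto_nhds_unique l1 ?_
  have : ∀ V : E N → E N, ∫ x in Ω, inner ℝ (V x) (φ x • e) = ∫ x in Ω, inner ℝ (V x) e * φ x := by
    intro V
    simp_rw [inner_smul_right, mul_comm]
  rw [this] at l2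
  refine l2.neg.congr fun n => ?_
  rw [this, integral_mul_fderiv_test hΩ ((h1 n).1.of_le (by simp)).contDiffOn hφ e]
  simp_rw [inner_gradient_left]

/-- The fundamental lemma of the calculus of variations, applied to each coordinate. It frees the
energy from the arbitrary choice made in `weakGradient`. -/
theorem HasWeakGradient.ae_eq {u : E N → ℝ} {U V : E N → E N} (hΩ : IsOpen Ω)
    (hU : HasWeakGradient Ω u U) (hV : HasWeakGradient Ω u V) :
    U =ᵐ[volume.restrict Ω] V := by
  have hint : ∀ {W : E N → E N}, LocallyIntegrableOn W Ω → ∀ e : E N, ∀ φ : E N → ℝ,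
      IsTestFunction Ω φ → Integrable (fun x => φ x • inner ℝ (W x) e) volume := by
    intro W hW e φ hφ
    have hWe : LocallyIntegrableOn (fun x => inner ℝ (W x) e) Ω := by
      intro x hx
      obtain ⟨s, hs, hi⟩ := hW x hx
      exact ⟨s, hs, hi.inner_const e⟩
    have h1 : IntegrableOn (fun x => inner ℝ (W x) e) (tsupport φ) :=
      hWe.integrableOn_compact_subset hφ.2.2 hφ.2.1
    have h2 := h1.continuousOn_smul hφ.1.continuous.continuousOn hφ.2.1
    refine (integrableOn_iff_integrable_of_support_subset ?_).1 h2
    intro x hx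
    refine subset_tsupport φ fun h0 => hx ?_
    simp [h0]
  have key : ∀ e : E N, ∀ᵐ x ∂volume, x ∈ Ω → inner ℝ (U x - V x) e = 0 := by
    intro e
    refine hΩ.ae_eq_zero_of_integral_contDiff_smul_eq_zero ?_ ?_
    · intro x hx
      obtain ⟨s, hs, hi⟩ := (hU.2.1.sub hV.2.1) x hx
      exact ⟨s, hs, hi.inner_const e⟩
    · intro φ a b c
      have hφ : IsTestFunction Ω φ := ⟨a, b, c⟩
      have h1 := (hU.2.2 φ hφ e).symm.trans (hV.2.2 φ hφ e)
      rw [neg_inj, setIntegral_eq_integral_of_tsupport, setIntegral_eq_integral_of_tsupport] at h1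
      · simp_rw [inner_sub_left, smul_sub]
        rw [integral_sub (hint hU.2.1 e φ hφ) (hint hV.2.1 e φ hφ)]
        simp_rw [smul_eq_mul, mul_comm (φ _)]
        rw [h1, sub_self]
      · intro x hx; simp [hφ.eq_zero hx]
      · intro x hx; simp [hφ.eq_zero hx]
  have := (ae_all_iff (ι := Fin N)).2 fun i => key (EuclideanSpace.basisFun (Fin N) ℝ i)
  rw [Filter.EventuallyEq, ae_restrict_iff' hΩ.measurableSet]
  filter_upwards [this] with x hx hxΩ
  rw [← sub_eq_zero]
  ext i
  simpa [EuclideanSpace.inner_single_right] using hx i hxΩ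

theorem SobolevPair.memH10 {u : E N → ℝ} {U : E N → E N}
    (hΩ : IsOpen Ω) (hu : SobolevPair Ω u U) : MemH10 Ω u :=
  ⟨hu.memLp, U, hu.hasWeakGradient hΩ, hu.memLp_grad, hu.approx⟩

theorem SobolevPair.weakGradient_ae_eq {u : E N → ℝ} {U : E N → E N}
    (hΩ : IsOpen Ω) (hu : SobolevPair Ω u U) : weakGradient Ω u =ᵐ[volume.restrict Ω] U := by
  have h : ∃ V, HasWeakGradient Ω u V := ⟨U, hu.hasWeakGradient hΩ⟩
  rw [weakGradient, dif_pos h]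
  exact h.choose_spec.ae_eq hΩ (hu.hasWeakGradient hΩ)

/-- Density: both sides are L²-continuous in the test pair. This is what allows testing the equation
with positive parts. -/
theorem SobolevPair.integral_inner_eq {u k z : E N → ℝ} {U Z : E N → E N}
    (hu : SobolevPair Ω u U) (hk : MemLp k 2 (volume.restrict Ω))
    (h : ∀ φ, IsTestFunction Ω φ → ∫ x in Ω, inner ℝ (U x) (gradient φ x) = ∫ x in Ω, k x * φ x)
    (hz : SobolevPair Ω z Z) : ∫ x in Ω, inner ℝ (U x) (Z x) = ∫ x in Ω, k x * z x := by
  obtain ⟨φ, h1, h2, h3⟩ := hz.approx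
  have l1 := tendsto_integral_mul_of_eLpNorm (fun n => (h1 n).memLp) hz.memLp hk h2
  have l2 := tendsto_integral_inner_of_eLpNorm (fun n => (h1 n).memLp_gradient) hz.memLp_grad
    hu.memLp_grad h3
  simp_rw [real_inner_comm (U _), mul_comm (k _)] at *
  refine tendsto_nhds_unique l2 (l1.congr fun n => ?_)
  exact (h _ (h1 n)).symm

/-- Diagonal argument: replace the `n`-th pair by a test function within `1/(n+1)` of it in both
norms. -/
theorem SobolevPair.of_tendsto {v : ℕ → E N → ℝ} {V : ℕ → E N → E N} {u : E N → ℝ} {U : E N → E N}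
    (hv : ∀ n, SobolevPair Ω (v n) (V n)) (hu : MemLp u 2 (volume.restrict Ω))
    (hU : MemLp U 2 (volume.restrict Ω))
    (h : Tendsto (fun n => eLpNorm (fun x => v n x - u x) 2 (volume.restrict Ω)) atTop (𝓝 0))
    (h' : Tendsto (fun n => eLpNorm (fun x => V n x - U x) 2 (volume.restrict Ω)) atTop (𝓝 0)) :
    SobolevPair Ω u U := by
  have : ∀ n : ℕ, ∃ φ, IsTestFunction Ω φ ∧
      eLpNorm (fun x => φ x - v n x) 2 (volume.restrict Ω) ≤ ((n : ENNReal) + 1)⁻¹ ∧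
      eLpNorm (fun x => gradient φ x - V n x) 2 (volume.restrict Ω) ≤ ((n : ENNReal) + 1)⁻¹ := by
    intro n
    obtain ⟨φ, h1, h2, h3⟩ := (hv n).approx
    have hpos : (0 : ENNReal) < ((n : ENNReal) + 1)⁻¹ := by
      simp [ENNReal.inv_pos]
    obtain ⟨m, hm⟩ := ((h2.eventually_le_const hpos).and (h3.eventually_le_const hpos)).exists
    exact ⟨φ m, h1 m, hm⟩
  choose φ h1 h2 h3 using this
  have hz : Tendsto (fun n : ℕ => ((n : ENNReal) + 1)⁻¹) atTop (𝓝 0) := by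
    have := (tendsto_add_atTop_iff_nat 1).2 ENNReal.tendsto_inv_nat_nhds_zero
    simpa using this
  refine ⟨hu, hU, φ, h1, ?_, ?_⟩
  · have h0 := hz.add h
    rw [add_zero] at h0
    refine tendsto_of_tendsto_of_tendsto_of_le_of_le tendsto_const_nhds h0 (fun _ => zero_le)
      fun n => ?_
    refine le_trans ?_ (add_le_add_left (h2 n) _)
    have := eLpNorm_add_le ((h1 n).memLp.1.sub (hv n).memLp.1) ((hv n).memLp.1.sub hu.1)
      (p := 2) (by norm_num)
    refine le_trans (le_of_eq ?_) this
    congr 1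
    ext x
    simp
  · have h0 := hz.add h'
    rw [add_zero] at h0
    refine tendsto_of_tendsto_of_tendsto_of_le_of_le tendsto_const_nhds h0 (fun _ => zero_le)
      fun n => ?_
    refine le_trans ?_ (add_le_add_left (h3 n) _)
    have := eLpNorm_add_le ((h1 n).memLp_gradient.1.sub (hv n).memLp_grad.1)
      ((hv n).memLp_grad.1.sub hU.1) (p := 2) (by norm_num)
    refine le_trans (le_of_eq ?_) this
    congr 1
    ext x
    simp

end SobolevPairs


/-! ### Positive parts cut off along a hyperplane -/

section PositivePart

/-- Rescaling `θ` to `s ↦ θ(n s) / n` approximates the positive part, with derivatives bounded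
uniformly in `n` and vanishing for `s < 1/n`. -/
theorem exists_smooth_positivePart : ∃ θ : ℝ → ℝ, ContDiff ℝ ∞ θ ∧ (∀ s ≤ 1, θ s = 0) ∧
    (∀ s, 2 ≤ s → θ s = s) ∧ ∃ C, ∀ s, |deriv θ s| ≤ C := by
  have hθ : ContDiff ℝ ∞ (fun s : ℝ => s * Real.smoothTransition (s - 1)) :=
    contDiff_id.mul (Real.smoothTransition.contDiff.comp (contDiff_id.sub contDiff_const))
  refine ⟨fun s => s * Real.smoothTransition (s - 1), hθ, ?_, ?_, ?_⟩
  · intro s hs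
    simp [Real.smoothTransition.zero_of_nonpos (sub_nonpos.2 hs)]
  · intro s hs
    simp [Real.smoothTransition.one_of_one_le (show (1 : ℝ) ≤ s - 1 by linarith)]
  · obtain ⟨C, hC⟩ := (isCompact_Icc (a := (1 : ℝ)) (b := 2)).exists_bound_of_continuousOn
      (hθ.continuous_deriv (by simp)).continuousOn
    refine ⟨max C 1, fun s => ?_⟩
    rcases lt_or_ge s 1 with h | h
    · have : (fun s : ℝ => s * Real.smoothTransition (s - 1)) =ᶠ[𝓝 s] fun _ => 0 := by
        filter_upwards [Iio_mem_nhds h] with t ht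
        simp [Real.smoothTransition.zero_of_nonpos (sub_nonpos.2 (le_of_lt ht))]
      rw [this.deriv_eq]
      simp
    · rcases le_or_gt s 2 with h' | h'
      · exact (hC s ⟨h, h'⟩).trans (le_max_left _ _)
      · have : (fun s : ℝ => s * Real.smoothTransition (s - 1)) =ᶠ[𝓝 s] fun t => t := by
          filter_upwards [Ioi_mem_nhds h'] with t ht
          simp only [mem_Ioi] at ht
          simp [Real.smoothTransition.one_of_one_le (show (1 : ℝ) ≤ t - 1 by linarith)]
        rw [this.deriv_eq]
        simp

variable {N : ℕ} {Ω : Set (E N)} {e : E N} {η : ℝ → ℝ} {δ C : ℝ}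

/-- The open half-space of the points with positive component along `e`. -/
def halfSpace (e : E N) : Set (E N) := {x | 0 < inner ℝ x e}

theorem isOpen_halfSpace (e : E N) : IsOpen (halfSpace e) :=
  isOpen_lt continuous_const (by fun_prop)

theorem abs_sub_le_of_deriv_le (hη : ContDiff ℝ ∞ η) (hC : ∀ s, |deriv η s| ≤ C) (s t : ℝ) :
    |η s - η t| ≤ C * |s - t| :=
  Convex.norm_image_sub_le_of_norm_deriv_le (fun x _ => hη.differentiable (by simp) x)
    (fun x _ => hC x) convex_univ (mem_univ t) (mem_univ s)

theorem deriv_eq_zero_of_lt (hη0 : ∀ s ≤ δ, η s = 0) {s : ℝ} (hs : s < δ) : deriv η s = 0 := by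
  have : η =ᶠ[𝓝 s] fun _ => 0 := by
    filter_upwards [Iio_mem_nhds hs] with t ht using hη0 t (le_of_lt ht)
  rw [this.deriv_eq]
  simp

/-- The cutoff creates no jump: near the hyperplane `φ` is below `δ`, where `η` is already zero.
Locally the truncated function is therefore either `η ∘ φ` or zero. -/
theorem indicator_comp_eventuallyEq (hδ : 0 < δ) (hη0 : ∀ s ≤ δ, η s = 0) {φ : E N → ℝ}
    (hφ : Continuous φ) (h0 : ∀ x, inner ℝ x e = 0 → φ x = 0) (x : E N) :
    (x ∈ halfSpace e ∧ (halfSpace e).indicator (fun x => η (φ x)) =ᶠ[𝓝 x] fun x => η (φ x)) ∨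
    ((x ∈ halfSpace e → φ x < δ) ∧
      (halfSpace e).indicator (fun x => η (φ x)) =ᶠ[𝓝 x] fun _ => 0) := by
  by_cases hx : x ∈ halfSpace e
  · left
    refine ⟨hx, ?_⟩
    filter_upwards [(isOpen_halfSpace e).mem_nhds hx] with y hy
    exact indicator_of_mem hy _
  · right
    refine ⟨fun h => absurd h hx, ?_⟩
    rcases (not_lt.1 hx : inner ℝ x e ≤ 0).lt_or_eq with h | h
    · have : {y : E N | inner ℝ y e < 0} ∈ 𝓝 x :=
        (isOpen_lt (by fun_prop) continuous_const).mem_nhds h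
      filter_upwards [this] with y hy
      have h' : y ∉ halfSpace e := fun h' => lt_asymm (show 0 < inner ℝ y e from h') hy
      simp [h']
    · have : {y : E N | φ y < δ} ∈ 𝓝 x :=
        (isOpen_lt hφ continuous_const).mem_nhds (by simpa [h0 x h] using hδ)
      filter_upwards [this] with y hy
      by_cases hy' : y ∈ halfSpace e
      · rw [indicator_of_mem hy', hη0 _ (le_of_lt hy)]
      · rw [indicator_of_notMem hy']

theorem IsTestFunction.indicator_comp (hη : ContDiff ℝ ∞ η) (hδ : 0 < δ)
    (hη0 : ∀ s ≤ δ, η s = 0) {φ : E N → ℝ} (hφ : IsTestFunction Ω φ)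
    (h0 : ∀ x, inner ℝ x e = 0 → φ x = 0) :
    IsTestFunction Ω ((halfSpace e).indicator fun x => η (φ x)) := by
  have hsub : Function.support ((halfSpace e).indicator fun x => η (φ x)) ⊆ Function.support φ := by
    intro x hx
    by_contra h
    refine hx ?_
    simp only [Function.mem_support, not_not] at h
    simp [h, hη0 0 hδ.le]
  refine ⟨?_, hφ.2.1.mono hsub, (closure_mono hsub).trans hφ.2.2⟩
  rw [contDiff_iff_contDiffAt]
  intro x
  rcases indicator_comp_eventuallyEq hδ hη0 hφ.1.continuous h0 x with ⟨-, h⟩ | ⟨-, h⟩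
  · exact (hη.comp hφ.1).contDiffAt.congr_of_eventuallyEq h
  · exact contDiffAt_const.congr_of_eventuallyEq h

theorem gradient_indicator_comp (hη : ContDiff ℝ ∞ η) (hδ : 0 < δ)
    (hη0 : ∀ s ≤ δ, η s = 0) {φ : E N → ℝ} (hφ : IsTestFunction Ω φ)
    (h0 : ∀ x, inner ℝ x e = 0 → φ x = 0) (x : E N) :
    gradient ((halfSpace e).indicator fun x => η (φ x)) x =
      (halfSpace e).indicator (fun x => deriv η (φ x) • gradient φ x) x := by
  rcases indicator_comp_eventuallyEq hδ hη0 hφ.1.continuous h0 x with ⟨hx, h⟩ | ⟨hx, h⟩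
  · rw [indicator_of_mem hx]
    refine ext_inner_right ℝ fun y => ?_
    rw [inner_gradient_left, h.fderiv_eq, inner_smul_left, inner_gradient_left]
    have h1 := ((hη.differentiable (by simp) (φ x)).hasDerivAt.comp_hasFDerivAt x
      (hφ.differentiable x).hasFDerivAt).fderiv
    simp only [Function.comp_def] at h1
    rw [h1]
    rfl
  · refine ext_inner_right ℝ fun y => ?_
    rw [inner_gradient_left, h.fderiv_eq]
    by_cases hx' : x ∈ halfSpace e
    · rw [indicator_of_mem hx', deriv_eq_zero_of_lt hη0 (hx hx')]
      simp
    · rw [indicator_of_notMem hx']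
      simp

/-- The truncations of the `φ n` are test functions because each `φ n` vanishes on the hyperplane;
it remains to show that they and their gradients converge. -/
theorem sobolevPair_indicator_comp (hη : ContDiff ℝ ∞ η) (hδ : 0 < δ)
    (hη0 : ∀ s ≤ δ, η s = 0) (hC : ∀ s, |deriv η s| ≤ C) {w : E N → ℝ} {W : E N → E N}
    (hw : MemLp w 2 (volume.restrict Ω)) (hW : MemLp W 2 (volume.restrict Ω))
    {φ : ℕ → E N → ℝ} (hφ : ∀ n, IsTestFunction Ω (φ n))
    (h0 : ∀ n x, inner ℝ x e = 0 → φ n x = 0)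
    (h1 : Tendsto (fun n => eLpNorm (fun x => φ n x - w x) 2 (volume.restrict Ω)) atTop (𝓝 0))
    (h2 : Tendsto (fun n => eLpNorm (fun x => gradient (φ n) x - W x) 2 (volume.restrict Ω))
      atTop (𝓝 0)) :
    SobolevPair Ω ((halfSpace e).indicator fun x => η (w x))
      ((halfSpace e).indicator fun x => deriv η (w x) • W x) := by
  set μ := (volume : Measure (E N)).restrict Ω
  have hA : MeasurableSet (halfSpace e) := (isOpen_halfSpace e).measurableSet
  have hC0 : 0 ≤ C := (abs_nonneg _).trans (hC 0)
  have hdc : Continuous (deriv η) := hη.continuous_deriv (by simp)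
  have hηw : MemLp (fun x => η (w x)) 2 μ := by
    refine (hw.const_mul C).mono (hη.continuous.comp_aestronglyMeasurable hw.1)
      (ae_of_all _ fun x => ?_)
    have := abs_sub_le_of_deriv_le hη hC (w x) 0
    rw [hη0 0 hδ.le, sub_zero, sub_zero] at this
    simpa [abs_mul, abs_of_nonneg hC0] using this
  have hbd : ∀ v : E N → ℝ, AEStronglyMeasurable v μ → ∀ V : E N → E N, MemLp V 2 μ →
      MemLp (fun x => deriv η (v x) • V x) 2 μ := by
    intro v hv V hV
    refine (hV.const_smul C).mono ((hdc.comp_aestronglyMeasurable hv).smul hV.1)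
      (ae_of_all _ fun x => ?_)
    simp only [norm_smul, Pi.smul_apply, Real.norm_eq_abs, abs_of_nonneg hC0]
    exact mul_le_mul_of_nonneg_right (hC _) (norm_nonneg _)
  -- The factor `deriv η (φ n)` converges only where `φ n` does, so an almost everywhere convergent
  -- subsequence is needed before dominated convergence can be used.
  obtain ⟨ns, hns, hae⟩ := (tendstoInMeasure_of_tendsto_eLpNorm (by norm_num)
    (fun n => (hφ n).memLp.1) hw.1 h1).exists_seq_tendsto_ae
  refine ⟨hηw.indicator hA, (hbd w hw.1 W hW).indicator hA,
    fun n => (halfSpace e).indicator fun x => η (φ (ns n) x),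
    fun n => (hφ _).indicator_comp hη hδ hη0 (h0 _), ?_, ?_⟩
  · have h3 := tendsto_eLpNorm_const_smul C (h1.comp hns.tendsto_atTop)
    refine tendsto_of_tendsto_of_tendsto_of_le_of_le tendsto_const_nhds h3 (fun _ => zero_le)
      fun n => eLpNorm_mono fun x => ?_
    simp only [smul_eq_mul, ← mul_sub, norm_mul, Real.norm_eq_abs, abs_of_nonneg hC0]
    by_cases hx : x ∈ halfSpace e
    · simp only [indicator_of_mem hx]
      exact abs_sub_le_of_deriv_le hη hC _ _
    · simp only [indicator_of_notMem hx]
      simpa using mul_nonneg hC0 (abs_nonneg _)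
  · have h3 := tendsto_eLpNorm_const_smul C (h2.comp hns.tendsto_atTop)
    have h4 : Tendsto (fun n => eLpNorm (fun x => deriv η (φ (ns n) x) • W x - deriv η (w x) • W x)
        2 μ) atTop (𝓝 0) := by
      refine tendsto_eLpNorm_two_of_dominated
        (fun n => (hbd _ (hφ _).memLp.1 W hW).1) (hbd w hw.1 W hW).1
        ((hW.norm).const_mul (2 * C)) (fun n => ae_of_all _ fun x => ?_) ?_
      · rw [← sub_smul, norm_smul]
        refine mul_le_mul_of_nonneg_right ?_ (norm_nonneg _)
        refine (norm_sub_le _ _).trans ?_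
        have := hC (φ (ns n) x)
        have := hC (w x)
        simp only [Real.norm_eq_abs]
        linarith
      · filter_upwards [hae] with x hx
        exact ((hdc.tendsto _).comp hx).smul_const _
    have h5 := h3.add h4
    rw [add_zero] at h5
    refine tendsto_of_tendsto_of_tendsto_of_le_of_le tendsto_const_nhds h5 (fun _ => zero_le)
      fun n => ?_
    have hg : MemLp (fun x => deriv η (φ (ns n) x) • gradient (φ (ns n)) x) 2 μ :=
      hbd _ (hφ _).memLp.1 _ (hφ _).memLp_gradient
    have hg' := hbd _ (hφ (ns n)).memLp.1 W hW
    -- Split the error by inserting `deriv η (φ (ns n)) • W`: one part is controlled by `h3`, the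
    -- other by `h4`.
    calc _ ≤ eLpNorm (fun x => deriv η (φ (ns n) x) • gradient (φ (ns n)) x
            - deriv η (w x) • W x) 2 μ := by
          refine eLpNorm_mono fun x => ?_
          rw [gradient_indicator_comp hη hδ hη0 (hφ _) (h0 _)]
          by_cases hx : x ∈ halfSpace e
          · simp only [indicator_of_mem hx]
            exact le_rfl
          · simp [indicator_of_notMem hx]
      _ ≤ eLpNorm (fun x => deriv η (φ (ns n) x) • gradient (φ (ns n)) x
            - deriv η (φ (ns n) x) • W x) 2 μ + _ := by
          refine le_trans (le_of_eq ?_)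
            (eLpNorm_add_le (hg.1.sub hg'.1) (hg'.1.sub (hbd w hw.1 W hW).1) (by norm_num))
          congr 1
          ext1 x
          simp
      _ ≤ _ := by
          refine add_le_add_left (eLpNorm_mono fun x => ?_) _
          rw [← smul_sub, ← smul_sub, norm_smul, norm_smul, Real.norm_eq_abs, Real.norm_eq_abs,
            abs_of_nonneg hC0]
          exact mul_le_mul_of_nonneg_right (hC _) (norm_nonneg _)

theorem sobolevPair_indicator_posPart {w : E N → ℝ} {W : E N → E N}
    (hw : MemLp w 2 (volume.restrict Ω)) (hW : MemLp W 2 (volume.restrict Ω))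
    {φ : ℕ → E N → ℝ} (hφ : ∀ n, IsTestFunction Ω (φ n))
    (h0 : ∀ n x, inner ℝ x e = 0 → φ n x = 0)
    (h1 : Tendsto (fun n => eLpNorm (fun x => φ n x - w x) 2 (volume.restrict Ω)) atTop (𝓝 0))
    (h2 : Tendsto (fun n => eLpNorm (fun x => gradient (φ n) x - W x) 2 (volume.restrict Ω))
      atTop (𝓝 0)) :
    SobolevPair Ω ((halfSpace e).indicator fun x => max (w x) 0)
      ((halfSpace e ∩ {x | 0 < w x}).indicator W) := by
  obtain ⟨θ, hθ, hθ0, hθ1, C, hC⟩ := exists_smooth_positivePart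
  have hC0 : 0 ≤ C := (abs_nonneg _).trans (hC 0)
  -- The bound on `deriv (η n)` is independent of `n`, so a constant multiple of `|w|`, respectively
  -- `‖W‖`, dominates in the limit.
  set η : ℕ → ℝ → ℝ := fun n s => ((n : ℝ) + 1)⁻¹ * θ (((n : ℝ) + 1) * s) with hη
  have hn : ∀ n : ℕ, (0 : ℝ) < (n : ℝ) + 1 := fun n => by positivity
  have hηs : ∀ n, ContDiff ℝ ∞ (η n) := fun n =>
    contDiff_const.mul (hθ.comp (contDiff_const.mul contDiff_id))
  have hηd : ∀ n s, deriv (η n) s = deriv θ (((n : ℝ) + 1) * s) := by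
    intro n s
    have h3 : HasDerivAt (fun s => θ (((n : ℝ) + 1) * s))
        (deriv θ (((n : ℝ) + 1) * s) * ((n : ℝ) + 1)) s :=
      (hθ.differentiable (by simp) _).hasDerivAt.comp s
        (by simpa using (hasDerivAt_id s).const_mul ((n : ℝ) + 1))
    rw [(h3.const_mul (((n : ℝ) + 1)⁻¹)).deriv]
    have := (hn n).ne'
    field_simp
  have hηC : ∀ n s, |deriv (η n) s| ≤ C := fun n s => by rw [hηd]; exact hC _
  have hη0 : ∀ n : ℕ, ∀ s ≤ ((n : ℝ) + 1)⁻¹, η n s = 0 := by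
    intro n s hs
    have : ((n : ℝ) + 1) * s ≤ 1 := by
      have := mul_le_mul_of_nonneg_left hs (hn n).le
      rwa [mul_inv_cancel₀ (hn n).ne'] at this
    simp [hη, hθ0 _ this]
  have hlarge : ∀ s : ℝ, 0 < s → ∀ᶠ n : ℕ in atTop, 2 < ((n : ℝ) + 1) * s := by
    intro s hs
    have : Tendsto (fun n : ℕ => ((n : ℝ) + 1) * s) atTop atTop :=
      (tendsto_natCast_atTop_atTop.atTop_add tendsto_const_nhds).atTop_mul_const hs
    exact this.eventually_gt_atTop 2
  have hpair := fun n => sobolevPair_indicator_comp (e := e) (hηs n) (inv_pos.2 (hn n)) (hη0 n)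
    (hηC n) hw hW hφ h0 h1 h2
  have hlim1 : ∀ x, Tendsto (fun n => (halfSpace e).indicator (fun x => η n (w x)) x) atTop
      (𝓝 ((halfSpace e).indicator (fun x => max (w x) 0) x)) := by
    intro x
    by_cases hx : x ∈ halfSpace e
    · simp only [indicator_of_mem hx]
      rcases le_or_gt (w x) 0 with h | h
      · rw [max_eq_right h]
        refine tendsto_const_nhds.congr fun n => ?_
        exact (hη0 n _ (h.trans (inv_pos.2 (hn n)).le)).symm
      · rw [max_eq_left h.le]
        refine tendsto_const_nhds.congr' ?_
        filter_upwards [hlarge _ h] with n hn'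
        simp only [hη]
        rw [hθ1 _ hn'.le, inv_mul_cancel_left₀ (hn n).ne']
    · simp [indicator_of_notMem hx]
  have hlim2 : ∀ x, Tendsto (fun n => (halfSpace e).indicator (fun x => deriv (η n) (w x) • W x) x)
      atTop (𝓝 ((halfSpace e ∩ {x | 0 < w x}).indicator W x)) := by
    intro x
    by_cases hx : x ∈ halfSpace e
    · simp only [indicator_of_mem hx]
      rcases le_or_gt (w x) 0 with h | h
      · rw [indicator_of_notMem (fun h' : x ∈ halfSpace e ∩ {x | 0 < w x} => not_lt.2 h h'.2)]
        refine tendsto_const_nhds.congr fun n => ?_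
        rw [deriv_eq_zero_of_lt (hη0 n) (h.trans_lt (inv_pos.2 (hn n))), zero_smul]
      · rw [indicator_of_mem (show x ∈ halfSpace e ∩ {x | 0 < w x} from ⟨hx, h⟩)]
        refine tendsto_const_nhds.congr' ?_
        filter_upwards [hlarge _ h] with n hn'
        have h3 : θ =ᶠ[𝓝 (((n : ℝ) + 1) * w x)] fun t => t := by
          filter_upwards [Ioi_mem_nhds hn'] with t ht using hθ1 t (le_of_lt ht)
        rw [hηd, h3.deriv_eq]
        simp
    · rw [indicator_of_notMem (fun h' : x ∈ halfSpace e ∩ {x | 0 < w x} => hx h'.1)]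
      simp [indicator_of_notMem hx]
  have hm1 : AEStronglyMeasurable ((halfSpace e).indicator fun x => max (w x) 0)
      (volume.restrict Ω) :=
    aestronglyMeasurable_of_tendsto_ae _ (fun n => (hpair n).memLp.1) (ae_of_all _ hlim1)
  have hm2 : AEStronglyMeasurable ((halfSpace e ∩ {x | 0 < w x}).indicator W)
      (volume.restrict Ω) :=
    aestronglyMeasurable_of_tendsto_ae _ (fun n => (hpair n).memLp_grad.1) (ae_of_all _ hlim2)
  have hz : MemLp ((halfSpace e).indicator fun x => max (w x) 0) 2 (volume.restrict Ω) := by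
    refine hw.mono hm1 (ae_of_all _ fun x => ?_)
    by_cases hx : x ∈ halfSpace e
    · rw [indicator_of_mem hx, Real.norm_eq_abs, Real.norm_eq_abs, abs_of_nonneg (le_max_right _ _)]
      exact max_le (le_abs_self _) (abs_nonneg _)
    · rw [indicator_of_notMem hx]
      simp
  have hZ : MemLp ((halfSpace e ∩ {x | 0 < w x}).indicator W) 2 (volume.restrict Ω) :=
    hW.mono hm2 (ae_of_all _ fun x => norm_indicator_le_norm_self _ _)
  refine SobolevPair.of_tendsto hpair hz hZ ?_ ?_
  · refine tendsto_eLpNorm_two_of_dominated (fun n => (hpair n).memLp.1) hm1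
      ((hw.norm).const_mul (C + 1)) (fun n => ae_of_all _ fun x => ?_) (ae_of_all _ hlim1)
    by_cases hx : x ∈ halfSpace e
    · simp only [indicator_of_mem hx]
      refine (norm_sub_le _ _).trans ?_
      have h3 := abs_sub_le_of_deriv_le (hηs n) (hηC n) (w x) 0
      rw [hη0 n 0 (inv_pos.2 (hn n)).le, sub_zero, sub_zero] at h3
      have h4 : |max (w x) 0| ≤ |w x| := by
        rw [abs_of_nonneg (le_max_right _ _)]
        exact max_le (le_abs_self _) (abs_nonneg _)
      simp only [Real.norm_eq_abs]
      linarith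
    · simp only [indicator_of_notMem hx]
      simp only [sub_zero, norm_zero]
      positivity
  · refine tendsto_eLpNorm_two_of_dominated (fun n => (hpair n).memLp_grad.1) hm2
      ((hW.norm).const_mul (C + 1)) (fun n => ae_of_all _ fun x => ?_) (ae_of_all _ hlim2)
    refine (norm_sub_le _ _).trans ?_
    have h3 : ‖(halfSpace e).indicator (fun x => deriv (η n) (w x) • W x) x‖ ≤ C * ‖W x‖ := by
      refine (norm_indicator_le_norm_self _ _).trans ?_
      rw [norm_smul]
      exact mul_le_mul_of_nonneg_right (hηC n _) (norm_nonneg _)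
    have h4 := norm_indicator_le_norm_self (s := halfSpace e ∩ {x | 0 < w x}) W x
    linarith

end PositivePart


/-! ### Superposition operators and their primitives -/

section Nemytskii

variable {N : ℕ} {Ω : Set (E N)} {f g : E N → ℝ → ℝ} {v w : E N → ℝ} {M C : ℝ}

/-- Discard a null set off which `f x` is continuous and agrees with measurable representatives at
all rational `t`. Continuity then yields measurability at every real `t`, and joint measurability.
-/
theorem IsCaratheodory.exists_measurable_modification (hf : IsCaratheodory Ω f) :
    ∃ k : E N → ℝ → ℝ, Measurable (Function.uncurry k) ∧ (∀ x, Continuous (k x)) ∧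
      ∀ᵐ x ∂volume.restrict Ω, k x = f x := by
  have hq : ∀ᵐ x ∂volume.restrict Ω, Continuous (f x) ∧
      ∀ q : ℚ, f x q = (hf.1 q).mk (fun x => f x q) x := by
    filter_upwards [hf.2, ae_all_iff.2 fun q : ℚ => (hf.1 q).ae_eq_mk] with x h1 h2
    exact ⟨h1, h2⟩
  obtain ⟨T, hT1, hT2, hT3⟩ := eventually_iff_exists_mem.1 hq |>.elim fun s hs =>
    (⟨(toMeasurable (volume.restrict Ω) sᶜ)ᶜ, (measurableSet_toMeasurable _ _).compl, by
      rw [mem_ae_iff, compl_compl, measure_toMeasurable]; exact hs.1, fun x hx => hs.2 x (by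
        by_contra h; exact hx (subset_toMeasurable _ _ h))⟩ :
      ∃ T : Set (E N), MeasurableSet T ∧ T ∈ ae (volume.restrict Ω) ∧ ∀ x ∈ T, Continuous (f x) ∧
        ∀ q : ℚ, f x q = (hf.1 q).mk (fun x => f x q) x)
  have hc : ∀ x, Continuous fun t => T.indicator (fun x => f x t) x := by
    intro x
    by_cases hx : x ∈ T
    · simpa only [indicator_of_mem hx] using (hT3 x hx).1
    · simpa only [indicator_of_notMem hx] using continuous_const
  have hmq : ∀ q : ℚ, Measurable (T.indicator fun x => f x q) := by
    intro q
    have : (T.indicator fun x => f x q) = T.indicator ((hf.1 q).mk (fun x => f x q)) :=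
      indicator_congr fun x hx => (hT3 x hx).2 q
    rw [this]
    exact (hf.1 q).measurable_mk.indicator hT1
  have hm : ∀ t : ℝ, Measurable (T.indicator fun x => f x t) := by
    intro t
    obtain ⟨r, -, -, hr⟩ := Real.exists_seq_rat_strictMono_tendsto t
    refine measurable_of_tendsto_metrizable (fun n => hmq (r n)) ?_
    rw [tendsto_pi_nhds]
    intro x
    exact ((hc x).tendsto t).comp hr
  refine ⟨fun x t => T.indicator (fun x => f x t) x, ?_, hc, ?_⟩
  · exact (measurable_uncurry_of_continuous_of_measurable (u := fun t => T.indicator fun x => f x t)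
      hc hm).comp measurable_swap
  · filter_upwards [hT2] with x hx
    ext t
    exact indicator_of_mem hx _

theorem IsCaratheodory.aestronglyMeasurable_comp (hf : IsCaratheodory Ω f)
    (hv : AEStronglyMeasurable v (volume.restrict Ω)) :
    AEStronglyMeasurable (fun x => f x (v x)) (volume.restrict Ω) := by
  obtain ⟨k, hk, -, hkf⟩ := hf.exists_measurable_modification
  have : AEMeasurable (fun x => k x (v x)) (volume.restrict Ω) :=
    hk.comp_aemeasurable (aemeasurable_id.prodMk hv.aemeasurable)
  refine this.aestronglyMeasurable.congr ?_
  filter_upwards [hkf] with x hx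
  rw [hx]

theorem IsCaratheodory.aestronglyMeasurable_primitive (hf : IsCaratheodory Ω f)
    (hv : AEStronglyMeasurable v (volume.restrict Ω)) :
    AEStronglyMeasurable (fun x => primitive f x (v x)) (volume.restrict Ω) := by
  obtain ⟨k, hk, -, hkf⟩ := hf.exists_measurable_modification
  -- Rescaling the primitive to the fixed interval `(0, 1]` makes it a parameter integral, whose
  -- measurability is standard.
  have h1 : StronglyMeasurable fun p : E N × ℝ => ∫ s in Ioc (0 : ℝ) 1, k p.1 (p.2 * s) := by
    refine StronglyMeasurable.integral_prod_right (f := fun (p : E N × ℝ) (s : ℝ) => k p.1 (p.2 * s))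
      (Measurable.stronglyMeasurable ?_)
    exact hk.comp ((measurable_fst.comp measurable_fst).prodMk
      ((measurable_snd.comp measurable_fst).mul measurable_snd))
  have h2 : AEMeasurable (fun x => v x * ∫ s in Ioc (0 : ℝ) 1, k x (v x * s))
      (volume.restrict Ω) :=
    hv.aemeasurable.mul (h1.measurable.comp_aemeasurable (aemeasurable_id.prodMk hv.aemeasurable))
  refine h2.aestronglyMeasurable.congr ?_
  filter_upwards [hkf] with x hx
  rw [hx, primitive, ← intervalIntegral.integral_of_le zero_le_one, ← smul_eq_mul,
    intervalIntegral.smul_integral_comp_mul_left]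
  simp

/-- Carathéodory functions that are bounded and Lipschitz in the second variable on bounded
intervals, uniformly in the first variable. -/
structure IsLocallyControlled (Ω : Set (E N)) (f : E N → ℝ → ℝ) : Prop where
  caratheodory : IsCaratheodory Ω f
  bound : ∀ M : ℝ, 0 < M → ∃ C : ℝ, 0 < C ∧ ∀ᵐ x ∂volume.restrict Ω,
    (∀ t ∈ Icc (-M) M, |f x t| ≤ C) ∧
      ∀ s ∈ Icc (-M) M, ∀ t ∈ Icc (-M) M, |f x s - f x t| ≤ C * |s - t|

theorem isLocallyControlled_of_growth (hf : IsCaratheodory Ω f) (hgr : SubcriticalGrowth Ω f)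
    (hlip : LocLipschitzInSecond Ω f) : IsLocallyControlled Ω f := by
  refine ⟨hf, fun M hM => ?_⟩
  obtain ⟨C, r, hC, hr, -, hb⟩ := hgr
  obtain ⟨C', hC', hl⟩ := hlip M hM
  have h0 : 0 < C * (M ^ (r - 1) + 1) := by positivity
  refine ⟨C * (M ^ (r - 1) + 1) + C', by positivity, ?_⟩
  filter_upwards [hb, hl] with x h1 h2
  refine ⟨fun t ht => (h1 t).trans ?_, fun s hs t ht => (h2 s hs t ht).trans ?_⟩
  · have h3 : |t| ^ (r - 1) ≤ M ^ (r - 1) :=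
      Real.rpow_le_rpow (abs_nonneg _) (abs_le.2 ht) (by linarith)
    have : C * (|t| ^ (r - 1) + 1) ≤ C * (M ^ (r - 1) + 1) := by gcongr
    linarith
  · exact mul_le_mul_of_nonneg_right (by linarith) (abs_nonneg _)

theorem IsLocallyControlled.add_const_mul (hf : IsLocallyControlled Ω f)
    (hg : IsLocallyControlled Ω g) (c : ℝ) :
    IsLocallyControlled Ω (fun x t => f x t + c * g x t) := by
  refine ⟨⟨fun t => (hf.1.1 t).add ((hg.1.1 t).const_mul c), ?_⟩, fun M hM => ?_⟩
  · filter_upwards [hf.1.2, hg.1.2] with x h1 h2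
    exact h1.add (continuous_const.mul h2)
  · obtain ⟨C, hC, h1⟩ := hf.2 M hM
    obtain ⟨C', hC', h2⟩ := hg.2 M hM
    refine ⟨C + |c| * C', by positivity, ?_⟩
    filter_upwards [h1, h2] with x h1 h2
    refine ⟨fun t ht => ?_, fun s hs t ht => ?_⟩
    · refine (abs_add_le _ _).trans ?_
      rw [abs_mul]
      gcongr
      exacts [h1.1 t ht, h2.1 t ht]
    · have e : f x s + c * g x s - (f x t + c * g x t) = (f x s - f x t) + c * (g x s - g x t) := by
        ring
      rw [e, add_mul, mul_assoc]
      refine (abs_add_le _ _).trans ?_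
      rw [abs_mul]
      gcongr
      exacts [h1.2 s hs t ht, h2.2 s hs t ht]

theorem primitive_add_const_mul {x : E N} (hf : Continuous (f x)) (hg : Continuous (g x))
    (c t : ℝ) : primitive (fun x t => f x t + c * g x t) x t =
      primitive f x t + c * primitive g x t := by
  simp only [primitive]
  have h := (hg.intervalIntegrable (μ := volume) 0 t).const_mul c
  rw [intervalIntegral.integral_add (hf.intervalIntegrable _ _) h,
    intervalIntegral.integral_const_mul]

theorem primitive_sub {x : E N} (hf : Continuous (f x)) (s t : ℝ) :
    primitive f x s - primitive f x t = ∫ τ in t..s, f x τ :=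
  intervalIntegral.integral_interval_sub_left (hf.intervalIntegrable _ _)
    (hf.intervalIntegrable _ _)

theorem abs_primitive_sub_le {x : E N} (hf : Continuous (f x))
    (hC : ∀ t ∈ Icc (-M) M, |f x t| ≤ C) {s t : ℝ} (hs : s ∈ Icc (-M) M) (ht : t ∈ Icc (-M) M) :
    |primitive f x s - primitive f x t| ≤ C * |s - t| := by
  rw [primitive_sub hf]
  rw [← Real.norm_eq_abs]
  refine intervalIntegral.norm_integral_le_of_norm_le_const fun τ hτ => hC τ ?_
  exact ordConnected_Icc.uIcc_subset ht hs (uIoc_subset_uIcc hτ)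

/-- The remainder is `∫ (f x τ - f x t) dτ` from `t` to `s`, whose integrand is at most `C |s - t|`
in absolute value. -/
theorem abs_primitive_sub_sub_le {x : E N} (hf : Continuous (f x)) (hC0 : 0 ≤ C)
    (hC : ∀ s ∈ Icc (-M) M, ∀ t ∈ Icc (-M) M, |f x s - f x t| ≤ C * |s - t|) {s t : ℝ}
    (hs : s ∈ Icc (-M) M) (ht : t ∈ Icc (-M) M) :
    |primitive f x s - primitive f x t - f x t * (s - t)| ≤ C * (s - t) ^ 2 := by
  have h1 : primitive f x s - primitive f x t - f x t * (s - t) = ∫ τ in t..s, (f x τ - f x t) := by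
    rw [primitive_sub hf, intervalIntegral.integral_sub (hf.intervalIntegrable _ _)
      (continuous_const.intervalIntegrable _ _)]
    simp [mul_comm]
  rw [h1, ← sq_abs (s - t), sq, ← mul_assoc, ← Real.norm_eq_abs]
  refine intervalIntegral.norm_integral_le_of_norm_le_const fun τ hτ => ?_
  refine (hC τ (ordConnected_Icc.uIcc_subset ht hs (uIoc_subset_uIcc hτ)) t ht).trans ?_
  exact mul_le_mul_of_nonneg_left (abs_sub_left_of_mem_uIcc (uIoc_subset_uIcc hτ)) hC0

/-- Measurable functions on `Ω` with absolute value at most `M`. -/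
structure IsBoundedOn (Ω : Set (E N)) (M : ℝ) (v : E N → ℝ) : Prop where
  aestronglyMeasurable : AEStronglyMeasurable v (volume.restrict Ω)
  mem_Icc : ∀ᵐ x ∂volume.restrict Ω, v x ∈ Icc (-M) M

theorem IsBoundedOn.mono {M' : ℝ} (hv : IsBoundedOn Ω M v) (h : M ≤ M') : IsBoundedOn Ω M' v :=
  ⟨hv.1, hv.2.mono fun _ hx => ⟨by linarith [hx.1], hx.2.trans h⟩⟩

theorem IsBoundedOn.add {M' : ℝ} (hv : IsBoundedOn Ω M v) (hw : IsBoundedOn Ω M' w) :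
    IsBoundedOn Ω (M + M') (fun x => v x + w x) := by
  refine ⟨hv.1.add hw.1, ?_⟩
  filter_upwards [hv.2, hw.2] with x h1 h2
  exact ⟨by linarith [h1.1, h2.1], by linarith [h1.2, h2.2]⟩

theorem IsBoundedOn.const_mul (hv : IsBoundedOn Ω M v) (c : ℝ) :
    IsBoundedOn Ω (|c| * M) (fun x => c * v x) := by
  refine ⟨hv.1.const_mul c, ?_⟩
  filter_upwards [hv.2] with x h1
  rw [Set.mem_Icc, ← abs_le, abs_mul]
  exact mul_le_mul_of_nonneg_left (abs_le.2 h1) (abs_nonneg _)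

theorem IsLocallyControlled.exists_isBoundedOn (hf : IsLocallyControlled Ω f) (hM : 0 < M) :
    ∃ C, ∀ v, IsBoundedOn Ω M v → IsBoundedOn Ω C (fun x => f x (v x)) := by
  obtain ⟨C, -, h⟩ := hf.2 M hM
  refine ⟨C, fun v hv => ⟨hf.1.aestronglyMeasurable_comp hv.1, ?_⟩⟩
  filter_upwards [h, hv.2] with x h1 h2
  exact abs_le.1 (h1.1 _ h2)

variable [IsFiniteMeasure ((volume : Measure (E N)).restrict Ω)]

theorem IsBoundedOn.memLp (hv : IsBoundedOn Ω M v) : MemLp v 2 (volume.restrict Ω) :=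
  MemLp.of_bound hv.1 M (hv.2.mono fun _ hx => abs_le.2 hx)

theorem IsLocallyControlled.memLp_comp (hf : IsLocallyControlled Ω f) (hM : 0 < M)
    (hv : IsBoundedOn Ω M v) : MemLp (fun x => f x (v x)) 2 (volume.restrict Ω) := by
  obtain ⟨C, hC⟩ := hf.exists_isBoundedOn hM
  exact (hC v hv).memLp

theorem IsLocallyControlled.integrable_primitive (hf : IsLocallyControlled Ω f) (hM : 0 < M)
    (hv : IsBoundedOn Ω M v) :
    Integrable (fun x => primitive f x (v x)) (volume.restrict Ω) := by
  obtain ⟨C, hC, h⟩ := hf.2 M hM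
  refine Integrable.of_bound (hf.1.aestronglyMeasurable_primitive hv.1) (C * M) ?_
  filter_upwards [h, hv.2, hf.1.2] with x h1 h2 h3
  have h4 := abs_primitive_sub_le h3 h1.1 h2 (t := 0) ⟨by linarith, hM.le⟩
  have h5 : primitive f x 0 = 0 := by simp [primitive]
  rw [h5, sub_zero, sub_zero] at h4
  exact h4.trans (mul_le_mul_of_nonneg_left (abs_le.2 h2) hC.le)

/-- Integrating the pointwise bounds over the finite measure gives Lipschitz and first-order Taylor
estimates in the sup norm. They replace differentiability of the functionals on `H^1_0`. -/
theorem IsLocallyControlled.exists_taylor_bound (hf : IsLocallyControlled Ω f) (hM : 0 < M) :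
    ∃ C, 0 < C ∧ ∀ v w d, 0 ≤ d → IsBoundedOn Ω M v → IsBoundedOn Ω M w →
      (∀ᵐ x ∂volume.restrict Ω, |w x - v x| ≤ d) →
      |(∫ x in Ω, primitive f x (w x)) - ∫ x in Ω, primitive f x (v x)| ≤ C * d ∧
      |(∫ x in Ω, primitive f x (w x)) - (∫ x in Ω, primitive f x (v x))
        - ∫ x in Ω, f x (v x) * (w x - v x)| ≤ C * d ^ 2 := by
  obtain ⟨C, hC, h⟩ := hf.2 M hM
  have hvol : 0 ≤ volume.real Ω := measureReal_nonneg
  refine ⟨C * (volume.real Ω + 1), by positivity, fun v w d hd0 hv hw hd => ?_⟩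
  have iv := hf.integrable_primitive hM hv
  have iw := hf.integrable_primitive hM hw
  have ivw : Integrable (fun x => f x (v x) * (w x - v x)) (volume.restrict Ω) :=
    (hf.memLp_comp hM hv).integrable_mul (hw.memLp.sub hv.memLp)
  have key : ∀ (k : E N → ℝ) (D : ℝ), 0 ≤ D → (∀ᵐ x ∂volume.restrict Ω, |k x| ≤ C * D) →
      |∫ x in Ω, k x| ≤ C * (volume.real Ω + 1) * D := by
    intro k D hD hk
    have := norm_integral_le_of_norm_le_const (f := k) hk
    simp only [measureReal_restrict_apply_univ, Real.norm_eq_abs] at this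
    nlinarith [mul_nonneg hC.le hD]
  have e1 := integral_sub iw iv
  have e2 := integral_sub (iw.sub iv) ivw
  simp only [Pi.sub_apply] at e2
  rw [e1] at e2
  rw [← e2, ← e1]
  constructor
  · refine key _ _ hd0 ?_
    filter_upwards [h, hv.2, hw.2, hf.1.2, hd] with x h1 h2 h3 h4 h5
    refine (abs_primitive_sub_le h4 h1.1 h3 h2).trans ?_
    gcongr
  · refine key _ _ (sq_nonneg d) ?_
    filter_upwards [h, hv.2, hw.2, hf.1.2, hd] with x h1 h2 h3 h4 h5
    refine (abs_primitive_sub_sub_le h4 hC.le h1.2 h3 h2).trans ?_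
    rw [← sq_abs]
    gcongr

end Nemytskii


/-! ### Geometry of the domain -/

section Domain

variable {N : ℕ} {Ω : Set (E N)}

theorem IsBallOrAnnulus.isOpen (h : IsBallOrAnnulus Ω) : IsOpen Ω := by
  rcases h with ⟨R, -, rfl⟩ | ⟨a, b, -, -, rfl⟩
  · exact isOpen_lt continuous_norm continuous_const
  · exact (isOpen_lt continuous_const continuous_norm).inter
      (isOpen_lt continuous_norm continuous_const)

theorem IsBallOrAnnulus.isBounded (h : IsBallOrAnnulus Ω) : Bornology.IsBounded Ω := by
  rcases h with ⟨R, -, rfl⟩ | ⟨a, b, -, -, rfl⟩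
  · exact isBounded_iff_forall_norm_le.2 ⟨R, fun x hx => le_of_lt hx⟩
  · exact isBounded_iff_forall_norm_le.2 ⟨b, fun x hx => le_of_lt hx.2⟩

theorem IsBallOrAnnulus.nonempty (h : IsBallOrAnnulus Ω) (hN : 2 ≤ N) : Ω.Nonempty := by
  have : Nontrivial (E N) := by
    have : Nonempty (Fin N) := ⟨⟨0, by omega⟩⟩
    infer_instance
  rcases h with ⟨R, hR, rfl⟩ | ⟨a, b, ha, hab, rfl⟩
  · exact ⟨0, by simpa using hR⟩
  · obtain ⟨x, hx⟩ := exists_norm_eq (E N) (show 0 ≤ (a + b) / 2 by linarith)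
    exact ⟨x, by rw [hx]; linarith, by rw [hx]; linarith⟩

theorem IsBallOrAnnulus.map_mem_iff (h : IsBallOrAnnulus Ω) (L : E N ≃ₗᵢ[ℝ] E N) (x : E N) :
    L x ∈ Ω ↔ x ∈ Ω := by
  rcases h with ⟨R, -, rfl⟩ | ⟨a, b, -, -, rfl⟩ <;> simp

theorem isFiniteMeasure_restrict (h : Bornology.IsBounded Ω) :
    IsFiniteMeasure ((volume : Measure (E N)).restrict Ω) :=
  ⟨by simpa using h.measure_lt_top⟩

theorem exists_abs_le_of_continuousOn_closure (h : Bornology.IsBounded Ω) {u : E N → ℝ}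
    (hu : ContinuousOn u (closure Ω)) : ∃ M, 0 < M ∧ ∀ x ∈ Ω, |u x| ≤ M := by
  obtain ⟨C, hC⟩ := h.isCompact_closure.exists_bound_of_continuousOn hu
  exact ⟨max C 1, by positivity, fun x hx => (hC x (subset_closure hx)).trans (le_max_left _ _)⟩

theorem isBoundedOn_of_continuousOn (hΩ : IsOpen Ω) {u : E N → ℝ} (hu : ContinuousOn u Ω)
    {M : ℝ} (hM : ∀ x ∈ Ω, |u x| ≤ M) : IsBoundedOn Ω M u :=
  ⟨hu.aestronglyMeasurable hΩ.measurableSet,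
    (ae_restrict_mem hΩ.measurableSet).mono fun x hx => abs_le.1 (hM x hx)⟩

theorem IsTestFunction.exists_abs_le {φ : E N → ℝ} (h : IsTestFunction Ω φ) :
    ∃ B, 0 < B ∧ ∀ x, |φ x| ≤ B := by
  obtain ⟨C, hC⟩ := h.2.1.exists_bound_of_continuous h.1.continuous
  exact ⟨max C 1, by positivity, fun x => (hC x).trans (le_max_left _ _)⟩

theorem ae_neBot_of_isOpen (hΩ : IsOpen Ω) (hne : Ω.Nonempty) :
    NeBot (ae ((volume : Measure (E N)).restrict Ω)) := by
  rw [ae_neBot, Ne, Measure.restrict_eq_zero]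
  exact (hΩ.measure_pos volume hne).ne'

end Domain

/-! ### Expansion of the energy and the Lagrange multiplier -/

section Energy

variable {N : ℕ} {Ω : Set (E N)} {f g : E N → ℝ → ℝ} {u v : E N → ℝ} {U V : E N → E N} {M : ℝ}

theorem integrable_sq_norm (hU : MemLp U 2 (volume.restrict Ω)) :
    Integrable (fun x => ‖U x‖ ^ 2) (volume.restrict Ω) :=
  (memLp_two_iff_integrable_sq_norm hU.1).1 hU

theorem integrable_mul_of_memLp (hu : MemLp u 2 (volume.restrict Ω))
    (hv : MemLp v 2 (volume.restrict Ω)) :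
    Integrable (fun x => u x * v x) (volume.restrict Ω) :=
  hu.integrable_mul hv

theorem integrable_inner (hU : MemLp U 2 (volume.restrict Ω)) (hV : MemLp V 2 (volume.restrict Ω)) :
    Integrable (fun x => inner ℝ (U x) (V x)) (volume.restrict Ω) := by
  refine ((hU.norm).integrable_mul (hV.norm)).mono (hU.1.inner hV.1) (ae_of_all _ fun x => ?_)
  simpa using abs_real_inner_le_norm (U x) (V x)

variable [IsFiniteMeasure ((volume : Measure (E N)).restrict Ω)]

theorem SobolevPair.energy_eq (hΩ : IsOpen Ω) (hu : SobolevPair Ω u U)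
    (hf : IsLocallyControlled Ω f) (hM : 0 < M) (hb : IsBoundedOn Ω M u) :
    energy Ω f u = (1 / 2) * (∫ x in Ω, ‖U x‖ ^ 2) - ∫ x in Ω, primitive f x (u x) := by
  rw [← integral_const_mul, ← integral_sub ((integrable_sq_norm hu.memLp_grad).const_mul _)
    (hf.integrable_primitive hM hb)]
  refine integral_congr_ae ?_
  filter_upwards [hu.weakGradient_ae_eq hΩ] with x hx
  rw [hx]

theorem SobolevPair.energy_add (hΩ : IsOpen Ω) (hu : SobolevPair Ω u U) (hv : SobolevPair Ω v V)
    (hf : IsLocallyControlled Ω f) (hM : 0 < M) (hb : IsBoundedOn Ω M u)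
    (hb' : IsBoundedOn Ω M (fun x => u x + v x)) :
    energy Ω f (fun x => u x + v x) - energy Ω f u = (∫ x in Ω, inner ℝ (U x) (V x))
      + (1 / 2) * (∫ x in Ω, ‖V x‖ ^ 2)
      - ((∫ x in Ω, primitive f x (u x + v x)) - ∫ x in Ω, primitive f x (u x)) := by
  rw [hu.energy_eq hΩ hf hM hb, (hu.add hv).energy_eq hΩ hf hM hb']
  have h1 : ∫ x in Ω, ‖U x + V x‖ ^ 2 = (∫ x in Ω, ‖U x‖ ^ 2)
      + 2 * (∫ x in Ω, inner ℝ (U x) (V x)) + ∫ x in Ω, ‖V x‖ ^ 2 := by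
    simp_rw [norm_add_sq_real]
    have i1 := integrable_sq_norm hu.memLp_grad
    have i2 := (integrable_inner hu.memLp_grad hv.memLp_grad).const_mul 2
    have i12 : Integrable (fun x => ‖U x‖ ^ 2 + 2 * inner ℝ (U x) (V x)) (volume.restrict Ω) :=
      i1.add i2
    rw [integral_add i12 (integrable_sq_norm hv.memLp_grad), integral_add i1 i2,
      integral_const_mul]
  rw [h1]
  ring

set_option maxHeartbeats 800000 in
-- The direction `φ` is tangent to the constraint and lowers the energy at unit rate. Moving by `t
-- (φ + θ ψ)`, a small `θ` corrects the second-order drift of the constraint, and the energy still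
-- drops.
theorem not_criticalDirection (hΩ : IsOpen Ω) (hu : SobolevPair Ω u U)
    (hf : IsLocallyControlled Ω f) (hg : IsLocallyControlled Ω g) (hM : 0 < M)
    (hb : IsBoundedOn Ω M u) (hcon : ∫ x in Ω, primitive g x (u x) = 1)
    (hmin : ∀ w ∈ constraintSet Ω g, energy Ω f u ≤ energy Ω f w) {φ ψ : E N → ℝ}
    (hφ : IsTestFunction Ω φ) (hψ : IsTestFunction Ω ψ)
    (hKφ : ∫ x in Ω, g x (u x) * φ x = 0) (hKψ : ∫ x in Ω, g x (u x) * ψ x = 1)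
    (hJφ : (∫ x in Ω, inner ℝ (U x) (gradient φ x)) - ∫ x in Ω, f x (u x) * φ x = -1) : False := by
  obtain ⟨B₁, hB₁, hφB⟩ := hφ.exists_abs_le
  obtain ⟨B₂, hB₂, hψB⟩ := hψ.exists_abs_le
  set B := B₁ + B₂ with hBdef
  have hB : 0 < B := by positivity
  have hM' : 0 < M + B := by positivity
  obtain ⟨Cf, hCf, hTf⟩ := hf.exists_taylor_bound hM'
  obtain ⟨Cg, hCg, hTg⟩ := hg.exists_taylor_bound hM'
  set Jψ := (∫ x in Ω, inner ℝ (U x) (gradient ψ x)) - ∫ x in Ω, f x (u x) * ψ x with hJψ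
  set Q := (∫ x in Ω, ‖gradient φ x‖ ^ 2) + ∫ x in Ω, ‖gradient ψ x‖ ^ 2 with hQ
  have hQ0 : 0 ≤ Q := add_nonneg (integral_nonneg fun x => by positivity)
    (integral_nonneg fun x => by positivity)
  -- For `|θ| ≤ δ` the correction costs at most half of the first-order gain `t`.
  obtain ⟨δ, hδ, hδ1, hδJ⟩ : ∃ δ : ℝ, 0 < δ ∧ δ ≤ 1 ∧ δ * |Jψ| ≤ 1 / 2 := by
    refine ⟨1 / (2 * (|Jψ| + 1)), by positivity, ?_, ?_⟩
    · rw [div_le_one (by positivity)]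
      linarith [abs_nonneg Jψ]
    · rw [div_mul_eq_mul_div, div_le_div_iff₀ (by positivity) (by norm_num)]
      linarith [abs_nonneg Jψ]
  -- The first bound on `t` makes the constraint values at `θ = -δ` and `θ = δ` enclose `1`; the
  -- second keeps the quadratic energy terms below the remaining gain `t / 2`.
  obtain ⟨t, ht, ht1, htg, htf⟩ : ∃ t : ℝ, 0 < t ∧ t ≤ 1 ∧ Cg * B ^ 2 * t ≤ δ ∧
      (Q + Cf * B ^ 2) * t < 1 / 2 := by
    refine ⟨min 1 (min (δ / (Cg * B ^ 2)) (1 / (4 * (Q + Cf * B ^ 2)))), by positivity,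
      min_le_left _ _, ?_, ?_⟩
    · rw [mul_comm, ← le_div_iff₀ (by positivity)]
      exact (min_le_right _ _).trans (min_le_left _ _)
    · have h1 : (0 : ℝ) < Q + Cf * B ^ 2 := by positivity
      calc _ ≤ (Q + Cf * B ^ 2) * (1 / (4 * (Q + Cf * B ^ 2))) := by
            gcongr
            exact (min_le_right _ _).trans (min_le_right _ _)
        _ = 1 / 4 := by field_simp
        _ < _ := by norm_num
  have hIcc : ∀ {θ : ℝ}, θ ∈ Icc (-δ) δ → |θ| ≤ 1 := fun hθ => (abs_le.2 hθ).trans hδ1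
  set p : ℝ → E N → ℝ := fun θ x => t * (φ x + θ * ψ x) with hp
  have hptest : ∀ θ, IsTestFunction Ω (p θ) := fun θ => (hφ.add (hψ.const_mul θ)).const_mul t
  have hple : ∀ {θ : ℝ}, θ ∈ Icc (-δ) δ → ∀ x, |p θ x| ≤ t * B := by
    intro θ hθ x
    simp only [hp, abs_mul, abs_of_pos ht]
    refine mul_le_mul_of_nonneg_left ((abs_add_le _ _).trans ?_) ht.le
    rw [abs_mul]
    refine add_le_add (hφB x) ?_
    calc |θ| * |ψ x| ≤ 1 * B₂ := by gcongr; exacts [hIcc hθ, hψB x]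
      _ = B₂ := one_mul _
  have hpb : ∀ {θ : ℝ}, θ ∈ Icc (-δ) δ → IsBoundedOn Ω (M + B) (fun x => u x + p θ x) := by
    intro θ hθ
    refine hb.add ⟨(hptest θ).1.continuous.aestronglyMeasurable, ae_of_all _ fun x => ?_⟩
    refine abs_le.1 ((hple hθ x).trans ?_)
    nlinarith
  have hb0 : IsBoundedOn Ω (M + B) u := hb.mono (by linarith)
  have ig : MemLp (fun x => g x (u x)) 2 (volume.restrict Ω) := hg.memLp_comp hM hb
  have iF : MemLp (fun x => f x (u x)) 2 (volume.restrict Ω) := hf.memLp_comp hM hb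
  have hlin : ∀ k : E N → ℝ, MemLp k 2 (volume.restrict Ω) → ∀ θ,
      ∫ x in Ω, k x * p θ x = t * ((∫ x in Ω, k x * φ x) + θ * ∫ x in Ω, k x * ψ x) := by
    intro k hk θ
    rw [← integral_const_mul θ, ← integral_add (integrable_mul_of_memLp hk hφ.memLp)
      ((integrable_mul_of_memLp hk hψ.memLp).const_mul θ), ← integral_const_mul]
    refine integral_congr_ae (ae_of_all _ fun x => ?_)
    simp only [hp]
    ring
  have hgrad : ∀ θ x, gradient (p θ) x = t • (gradient φ x + θ • gradient ψ x) := by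
    intro θ x
    simp only [hp]
    rw [gradient_const_mul (hφ.add (hψ.const_mul θ)).differentiable,
      gradient_add hφ.differentiable (hψ.const_mul θ).differentiable,
      gradient_const_mul hψ.differentiable]
  have hlinU : ∀ θ, ∫ x in Ω, inner ℝ (U x) (gradient (p θ) x) =
      t * ((∫ x in Ω, inner ℝ (U x) (gradient φ x))
        + θ * ∫ x in Ω, inner ℝ (U x) (gradient ψ x)) := by
    intro θ
    rw [← integral_const_mul θ, ← integral_add (integrable_inner hu.memLp_grad hφ.memLp_gradient)
      ((integrable_inner hu.memLp_grad hψ.memLp_gradient).const_mul θ), ← integral_const_mul]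
    refine integral_congr_ae (ae_of_all _ fun x => ?_)
    simp only [hgrad, inner_smul_right, inner_add_right]
  have hquad : ∀ {θ : ℝ}, θ ∈ Icc (-δ) δ →
      (1 / 2) * ∫ x in Ω, ‖gradient (p θ) x‖ ^ 2 ≤ t ^ 2 * Q := by
    intro θ hθ
    have i1 := integrable_sq_norm hφ.memLp_gradient
    have i2 := integrable_sq_norm hψ.memLp_gradient
    rw [hQ, ← integral_add i1 i2, ← integral_const_mul, ← integral_const_mul]
    refine integral_mono ((integrable_sq_norm (hptest θ).memLp_gradient).const_mul _)
      ((i1.add i2).const_mul _) fun x => ?_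
    simp only [hgrad, norm_smul, Real.norm_eq_abs, abs_of_pos ht, mul_pow]
    have h1 : ‖gradient φ x + θ • gradient ψ x‖ ≤ ‖gradient φ x‖ + ‖gradient ψ x‖ := by
      refine (norm_add_le _ _).trans ?_
      rw [norm_smul]
      have := mul_le_mul_of_nonneg_right (hIcc hθ) (norm_nonneg (gradient ψ x))
      simp only [Real.norm_eq_abs]
      linarith
    have h2 : ‖gradient φ x + θ • gradient ψ x‖ ^ 2 ≤
        2 * (‖gradient φ x‖ ^ 2 + ‖gradient ψ x‖ ^ 2) := by
      have := pow_le_pow_left₀ (norm_nonneg _) h1 2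
      nlinarith [sq_nonneg (‖gradient φ x‖ - ‖gradient ψ x‖)]
    nlinarith [sq_nonneg t]
  set Γ : ℝ → ℝ := fun θ => ∫ x in Ω, primitive g x (u x + p θ x) with hΓ
  have hΓt : ∀ {θ : ℝ}, θ ∈ Icc (-δ) δ → |Γ θ - 1 - t * θ| ≤ Cg * (t * B) ^ 2 := by
    intro θ hθ
    have h1 := (hTg u _ (t * B) (by positivity) hb0 (hpb hθ)
      (ae_of_all _ fun x => by simpa using hple hθ x)).2
    simp only [add_sub_cancel_left] at h1
    rwa [hcon, hlin _ ig, hKφ, hKψ, zero_add, mul_one] at h1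
  have hΓc : ContinuousOn Γ (Icc (-δ) δ) := by
    have : LipschitzOnWith (Real.toNNReal (Cg * (t * B₂))) Γ (Icc (-δ) δ) := by
      refine LipschitzOnWith.of_dist_le_mul fun θ hθ θ' hθ' => ?_
      rw [Real.coe_toNNReal _ (by positivity), Real.dist_eq, Real.dist_eq]
      have h1 := (hTg _ _ (t * B₂ * |θ - θ'|) (by positivity) (hpb hθ') (hpb hθ)
        (ae_of_all _ fun x => by
          have : u x + p θ x - (u x + p θ' x) = t * ((θ - θ') * ψ x) := by
            simp only [hp]; ring
          rw [this, abs_mul, abs_mul, abs_of_pos ht, mul_assoc]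
          refine mul_le_mul_of_nonneg_left ?_ ht.le
          rw [mul_comm]
          exact mul_le_mul_of_nonneg_right (hψB x) (abs_nonneg _))).1
      refine h1.trans (le_of_eq ?_)
      ring
    exact this.continuousOn
  have hend : Cg * (t * B) ^ 2 ≤ t * δ := by
    have := mul_le_mul_of_nonneg_left htg ht.le
    nlinarith
  obtain ⟨θ, hθ, hθ1⟩ : ∃ θ ∈ Icc (-δ) δ, Γ θ = 1 := by
    have hm := abs_le.1 (hΓt (left_mem_Icc.2 (by linarith : -δ ≤ δ)))
    have hp' := abs_le.1 (hΓt (right_mem_Icc.2 (by linarith : -δ ≤ δ)))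
    exact intermediate_value_Icc (by linarith) hΓc ⟨by linarith [hm.2], by linarith [hp'.1]⟩
  have hpair := hu.add (hptest θ).sobolevPair
  have h0 := hmin _ ⟨hpair.memH10 hΩ, hθ1⟩
  have h1 := hu.energy_add hΩ (hptest θ).sobolevPair hf hM' hb0 (hpb hθ)
  have h2 := (abs_le.1 (hTf u _ (t * B) (by positivity) hb0 (hpb hθ)
      (ae_of_all _ fun x => by simpa using hple hθ x)).2).1
  simp only [add_sub_cancel_left] at h2
  rw [hlin _ iF] at h2
  rw [hlinU] at h1
  have h3 := hquad hθ
  have h4 : θ * Jψ ≤ 1 / 2 := by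
    refine (le_abs_self _).trans ?_
    rw [abs_mul]
    exact (mul_le_mul_of_nonneg_right (abs_le.2 hθ) (abs_nonneg _)).trans hδJ
  have h5 : t * (((Q + Cf * B ^ 2) * t) - 1 / 2) < 0 := mul_neg_of_pos_of_neg ht (by linarith)
  have h6 : t * (θ * Jψ) ≤ t * (1 / 2) := mul_le_mul_of_nonneg_left h4 ht.le
  have e1 : t * ((∫ x in Ω, inner ℝ (U x) (gradient φ x))
      + θ * ∫ x in Ω, inner ℝ (U x) (gradient ψ x)) =
      t * ((∫ x in Ω, f x (u x) * φ x) + θ * ∫ x in Ω, f x (u x) * ψ x) - t + t * (θ * Jψ) := by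
    rw [eq_add_of_sub_eq hJφ, hJψ]
    ring
  have e2 : Cf * (t * B) ^ 2 + t ^ 2 * Q = t * ((Q + Cf * B ^ 2) * t) := by ring
  rw [e1] at h1
  linarith

/-- With `J` and `K` the first variations of energy and constraint, `J` must be the multiple `J ψ /
K ψ` of `K`; otherwise subtracting a multiple of `ψ` from a test function produces a forbidden
direction. -/
theorem exists_multiplier (hΩ : IsOpen Ω) (hu : SobolevPair Ω u U)
    (hf : IsLocallyControlled Ω f) (hg : IsLocallyControlled Ω g) (hM : 0 < M)
    (hb : IsBoundedOn Ω M u) (hcon : ∫ x in Ω, primitive g x (u x) = 1)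
    (hmin : ∀ w ∈ constraintSet Ω g, energy Ω f u ≤ energy Ω f w)
    (hne : ∃ ψ, IsTestFunction Ω ψ ∧ ∫ x in Ω, g x (u x) * ψ x ≠ 0) :
    ∃ lam : ℝ, ∀ φ, IsTestFunction Ω φ → ∫ x in Ω, inner ℝ (U x) (gradient φ x) =
      ∫ x in Ω, (f x (u x) + lam * g x (u x)) * φ x := by
  obtain ⟨ψ, hψ, hKψ⟩ := hne
  have ig : MemLp (fun x => g x (u x)) 2 (volume.restrict Ω) := hg.memLp_comp hM hb
  have iF : MemLp (fun x => f x (u x)) 2 (volume.restrict Ω) := hf.memLp_comp hM hb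
  have hlin : ∀ k : E N → ℝ, MemLp k 2 (volume.restrict Ω) → ∀ φ₁ φ₂, IsTestFunction Ω φ₁ →
      IsTestFunction Ω φ₂ → ∀ a b : ℝ, ∫ x in Ω, k x * (a * φ₁ x + b * φ₂ x) =
        a * (∫ x in Ω, k x * φ₁ x) + b * ∫ x in Ω, k x * φ₂ x := by
    intro k hk φ₁ φ₂ h₁ h₂ a b
    rw [← integral_const_mul, ← integral_const_mul, ← integral_add
      ((integrable_mul_of_memLp hk h₁.memLp).const_mul a) ((integrable_mul_of_memLp hk h₂.memLp).const_mul b)]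
    refine integral_congr_ae (ae_of_all _ fun x => ?_)
    ring
  have hlinU : ∀ φ₁ φ₂, IsTestFunction Ω φ₁ → IsTestFunction Ω φ₂ → ∀ a b : ℝ,
      ∫ x in Ω, inner ℝ (U x) (gradient (fun x => a * φ₁ x + b * φ₂ x) x) =
        a * (∫ x in Ω, inner ℝ (U x) (gradient φ₁ x))
          + b * ∫ x in Ω, inner ℝ (U x) (gradient φ₂ x) := by
    intro φ₁ φ₂ h₁ h₂ a b
    rw [← integral_const_mul, ← integral_const_mul, ← integral_add
      ((integrable_inner hu.memLp_grad h₁.memLp_gradient).const_mul a)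
      ((integrable_inner hu.memLp_grad h₂.memLp_gradient).const_mul b)]
    refine integral_congr_ae (ae_of_all _ fun x => ?_)
    simp only
    rw [gradient_add (h₁.const_mul a).differentiable (h₂.const_mul b).differentiable,
      gradient_const_mul h₁.differentiable, gradient_const_mul h₂.differentiable,
      inner_add_right, inner_smul_right, inner_smul_right]
  set K : (E N → ℝ) → ℝ := fun φ => ∫ x in Ω, g x (u x) * φ x with hK
  set J : (E N → ℝ) → ℝ := fun φ => (∫ x in Ω, inner ℝ (U x) (gradient φ x))
    - ∫ x in Ω, f x (u x) * φ x with hJ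
  have hKψ' : K ψ ≠ 0 := hKψ
  have hJlin : ∀ φ₁ φ₂, IsTestFunction Ω φ₁ → IsTestFunction Ω φ₂ → ∀ a b : ℝ,
      J (fun x => a * φ₁ x + b * φ₂ x) = a * J φ₁ + b * J φ₂ := by
    intro φ₁ φ₂ h₁ h₂ a b
    simp only [hJ]
    rw [hlinU φ₁ φ₂ h₁ h₂, hlin _ iF φ₁ φ₂ h₁ h₂]
    ring
  have hKlin : ∀ φ₁ φ₂, IsTestFunction Ω φ₁ → IsTestFunction Ω φ₂ → ∀ a b : ℝ,
      K (fun x => a * φ₁ x + b * φ₂ x) = a * K φ₁ + b * K φ₂ := fun φ₁ φ₂ h₁ h₂ a b =>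
    hlin _ ig φ₁ φ₂ h₁ h₂ a b
  refine ⟨J ψ / K ψ, fun φ hφ => ?_⟩
  have key : J φ = J ψ / K ψ * K φ := by
    by_contra hne
    -- Normalizes the tangential part of `φ` so that its first variation of energy is `-1`.
    set c := -(J φ - J ψ / K ψ * K φ)⁻¹ with hc
    have hne' : J φ - J ψ / K ψ * K φ ≠ 0 := sub_ne_zero.2 hne
    refine not_criticalDirection hΩ hu hf hg hM hb hcon hmin
      (φ := fun x => c * φ x + (-(c * K φ / K ψ)) * ψ x) (ψ := fun x => (K ψ)⁻¹ * ψ x)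
      ((hφ.const_mul _).add (hψ.const_mul _)) (hψ.const_mul _) ?_ ?_ ?_
    · refine (hKlin φ ψ hφ hψ _ _).trans ?_
      field_simp
      ring
    · have := hKlin ψ ψ hψ hψ (K ψ)⁻¹ 0
      simp only [zero_mul, add_zero] at this
      refine this.trans ?_
      field_simp
    · refine (hJlin φ ψ hφ hψ _ _).trans ?_
      have : c * J φ + -(c * K φ / K ψ) * J ψ = c * (J φ - J ψ / K ψ * K φ) := by
        field_simp
        ring
      rw [this, hc, neg_mul, inv_mul_cancel₀ hne']
  have e1 : ∫ x in Ω, (f x (u x) + J ψ / K ψ * g x (u x)) * φ x =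
      (∫ x in Ω, f x (u x) * φ x) + J ψ / K ψ * K φ := by
    rw [show K φ = ∫ x in Ω, g x (u x) * φ x from rfl, ← integral_const_mul, ← integral_add (integrable_mul_of_memLp iF hφ.memLp)
      ((integrable_mul_of_memLp ig hφ.memLp).const_mul _)]
    refine integral_congr_ae (ae_of_all _ fun x => ?_)
    ring
  rw [e1, ← key]
  simp only [hJ]
  ring

end Energy

/-! ### From the weak to the pointwise equation -/

section EulerLagrange

variable {N : ℕ} {Ω : Set (E N)} {f g : E N → ℝ → ℝ} {u φ : E N → ℝ} {U : E N → E N} {M : ℝ}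

theorem contDiffOn_fderiv_apply (hΩ : IsOpen Ω) (hu : ContDiffOn ℝ 2 u Ω) (e : E N) :
    ContDiffOn ℝ 1 (fun x => fderiv ℝ u x e) Ω :=
  (hu.fderiv_of_isOpen hΩ (by norm_num)).clm_apply contDiffOn_const

theorem laplacian_eq_sum_fderiv (hΩ : IsOpen Ω) (hu : ContDiffOn ℝ 2 u Ω) {x : E N} (hx : x ∈ Ω) :
    Laplacian.laplacian u x = ∑ i, fderiv ℝ
      (fun y => fderiv ℝ u y (EuclideanSpace.basisFun (Fin N) ℝ i)) x
        (EuclideanSpace.basisFun (Fin N) ℝ i) := by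
  rw [InnerProductSpace.laplacian_eq_iteratedFDeriv_orthonormalBasis u
    (EuclideanSpace.basisFun (Fin N) ℝ)]
  refine Finset.sum_congr rfl fun i _ => ?_
  have hd : DifferentiableAt ℝ (fderiv ℝ u) x :=
    ((hu.fderiv_of_isOpen hΩ (m := 1) (by norm_num)).contDiffAt (hΩ.mem_nhds hx)).differentiableAt
      (by simp)
  rw [iteratedFDeriv_two_apply, fderiv_clm_apply hd (differentiableAt_const _)]
  simp

theorem continuousOn_laplacian (hΩ : IsOpen Ω) (hu : ContDiffOn ℝ 2 u Ω) :
    ContinuousOn (Laplacian.laplacian u) Ω := by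
  refine ContinuousOn.congr ?_ fun x hx => laplacian_eq_sum_fderiv hΩ hu hx
  exact continuousOn_finsetSum _ fun i _ =>
    ((contDiffOn_fderiv_apply hΩ hu _).continuousOn_fderiv_of_isOpen hΩ le_rfl).clm_apply
      continuousOn_const

theorem hasWeakGradient_gradient (hΩ : IsOpen Ω) (hu : ContDiffOn ℝ 1 u Ω) :
    HasWeakGradient Ω u (gradient u) := by
  refine ⟨hu.continuousOn.locallyIntegrableOn hΩ.measurableSet, ?_, fun φ hφ e => ?_⟩
  · refine ContinuousOn.locallyIntegrableOn ?_ hΩ.measurableSet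
    exact (InnerProductSpace.toDual ℝ (E N)).symm.continuous.comp_continuousOn
      (hu.continuousOn_fderiv_of_isOpen hΩ le_rfl)
  · rw [integral_mul_fderiv_test hΩ hu hφ e]
    simp_rw [inner_gradient_left]

theorem integral_inner_gradient_test (hΩ : IsOpen Ω) (hu : ContDiffOn ℝ 2 u Ω)
    (hφ : IsTestFunction Ω φ) :
    ∫ x in Ω, inner ℝ (gradient u x) (gradient φ x) =
      -∫ x in Ω, Laplacian.laplacian u x * φ x := by
  have h1 : ∀ x, inner ℝ (gradient u x) (gradient φ x) = ∑ i,
      fderiv ℝ u x (EuclideanSpace.basisFun (Fin N) ℝ i)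
        * fderiv ℝ φ x (EuclideanSpace.basisFun (Fin N) ℝ i) := by
    intro x
    rw [← (EuclideanSpace.basisFun (Fin N) ℝ).sum_inner_mul_inner]
    refine Finset.sum_congr rfl fun i _ => ?_
    rw [inner_gradient_left, real_inner_comm, inner_gradient_left]
  simp_rw [h1]
  have h2 : ∫ x in Ω, Laplacian.laplacian u x * φ x = ∫ x in Ω, ∑ i, fderiv ℝ
      (fun y => fderiv ℝ u y (EuclideanSpace.basisFun (Fin N) ℝ i)) x
        (EuclideanSpace.basisFun (Fin N) ℝ i) * φ x := by
    refine setIntegral_congr_fun hΩ.measurableSet fun x hx => ?_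
    rw [laplacian_eq_sum_fderiv hΩ hu hx, Finset.sum_mul]
  rw [h2, integral_finsetSum, integral_finsetSum, ← Finset.sum_neg_distrib]
  · exact Finset.sum_congr rfl fun i _ =>
      integral_mul_fderiv_test hΩ (contDiffOn_fderiv_apply hΩ hu _) hφ _
  · intro i _
    exact (integrable_mul_test hΩ ((contDiffOn_fderiv_apply hΩ hu _).continuousOn_fderiv_of_isOpen
      hΩ le_rfl |>.clm_apply continuousOn_const) hφ).restrict
  · intro i _
    exact (integrable_mul_test hΩ (contDiffOn_fderiv_apply hΩ hu _).continuousOn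
      (hφ.fderiv_apply _)).restrict

/-- By uniqueness of weak gradients `U` is the classical gradient; integrating by parts once more
and applying the fundamental lemma gives the equation. -/
theorem solvesWithMultiplier_of_weak {lam : ℝ} (hΩ : IsOpen Ω) (hu2 : ContDiffOn ℝ 2 u Ω)
    (hu : SobolevPair Ω u U)
    (hk : MemLp (fun x => f x (u x) + lam * g x (u x)) 2 (volume.restrict Ω))
    (h : ∀ φ, IsTestFunction Ω φ → ∫ x in Ω, inner ℝ (U x) (gradient φ x) =
      ∫ x in Ω, (f x (u x) + lam * g x (u x)) * φ x) :
    SolvesWithMultiplier Ω f g u lam := by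
  have hUu : U =ᵐ[volume.restrict Ω] gradient u :=
    (hu.hasWeakGradient hΩ).ae_eq hΩ (hasWeakGradient_gradient hΩ (hu2.of_le (by norm_num)))
  have hlap : LocallyIntegrableOn (Laplacian.laplacian u) Ω :=
    (continuousOn_laplacian hΩ hu2).locallyIntegrableOn hΩ.measurableSet
  have key := hΩ.ae_eq_zero_of_integral_contDiff_smul_eq_zero (μ := volume)
    (f := fun x => Laplacian.laplacian u x + (f x (u x) + lam * g x (u x)))
    (hlap.add (locallyIntegrableOn_of_locallyIntegrable_restrict
      (hk.locallyIntegrable (by norm_num)))) fun φ a b c => by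
        have hφ : IsTestFunction Ω φ := ⟨a, b, c⟩
        have h1 := h φ hφ
        have h2 : ∫ x in Ω, inner ℝ (U x) (gradient φ x) =
            ∫ x in Ω, inner ℝ (gradient u x) (gradient φ x) := by
          refine integral_congr_ae ?_
          filter_upwards [hUu] with x hx
          rw [hx]
        rw [h2, integral_inner_gradient_test hΩ hu2 hφ] at h1
        rw [← setIntegral_eq_integral_of_tsupport (Ω := Ω)
          (fun x hx => by simp [hφ.eq_zero hx])]
        simp_rw [smul_eq_mul, mul_comm (φ _), add_mul]
        simp_rw [add_mul] at h1
        have i1 := (integrable_mul_test hΩ (continuousOn_laplacian hΩ hu2) hφ).restrict (s := Ω)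
        have i2 : Integrable (fun x => f x (u x) * φ x + lam * g x (u x) * φ x)
            (volume.restrict Ω) := by
          refine (integrable_mul_of_memLp hk hφ.memLp).congr (ae_of_all _ fun x => ?_)
          ring
        rw [integral_add i1 i2, ← h1]
        ring
  rw [SolvesWithMultiplier, ae_restrict_iff' hΩ.measurableSet]
  filter_upwards [key] with x hx hxΩ
  linarith [hx hxΩ]

end EulerLagrange


/-! ### Matching two expansions; convex functions and their chords -/

section RealLemmas

/-- Both functions start at zero with positive slope. Fix `t₀` with `A t₀ > 0`, take `s` so small
that `0 < B s ≤ A t₀`, and apply the intermediate value theorem to `A` on `[0, t₀]`. -/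
theorem exists_eq_of_expansion {A B : ℝ → ℝ} {a b K : ℝ} (ha : 0 < a) (hb : 0 < b) (hK : 0 < K)
    (hA : ∀ t ∈ Icc (0 : ℝ) 1, |A t - t * a| ≤ K * t ^ 2)
    (hB : ∀ t ∈ Icc (0 : ℝ) 1, |B t - t * b| ≤ K * t ^ 2) (hAc : ContinuousOn A (Icc 0 1)) :
    ∃ t ∈ Ioc (0 : ℝ) 1, ∃ s ∈ Ioc (0 : ℝ) 1, A t = B s := by
  obtain ⟨t₀, ht₀, ht₁, hta⟩ : ∃ t : ℝ, 0 < t ∧ t ≤ 1 ∧ K * t ≤ a / 2 := by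
    refine ⟨min 1 (a / (2 * K)), by positivity, min_le_left _ _, ?_⟩
    calc K * min 1 (a / (2 * K)) ≤ K * (a / (2 * K)) := by gcongr; exact min_le_right _ _
      _ = a / 2 := by field_simp
  have hAt : t₀ * a / 2 ≤ A t₀ := by
    have := (abs_le.1 (hA t₀ ⟨ht₀.le, ht₁⟩)).1
    nlinarith
  have hAp : 0 < t₀ * a / 2 := by positivity
  obtain ⟨s, hs₀, hs₁, hsb, hsA⟩ : ∃ s : ℝ, 0 < s ∧ s ≤ 1 ∧ K * s ≤ b / 2 ∧
      (b + K) * s ≤ t₀ * a / 2 := by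
    refine ⟨min 1 (min (b / (2 * K)) (t₀ * a / 2 / (b + K))), by positivity, min_le_left _ _, ?_, ?_⟩
    · calc _ ≤ K * (b / (2 * K)) := by
            gcongr; exact (min_le_right _ _).trans (min_le_left _ _)
        _ = b / 2 := by field_simp
    · calc _ ≤ (b + K) * (t₀ * a / 2 / (b + K)) := by
            gcongr; exact (min_le_right _ _).trans (min_le_right _ _)
        _ = t₀ * a / 2 := by field_simp
  have hBs := abs_le.1 (hB s ⟨hs₀.le, hs₁⟩)
  have hB0 : 0 < B s := by nlinarith [mul_pos hs₀ hb]
  have hBA : B s ≤ A t₀ := by nlinarith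
  have hA0 : A 0 = 0 := by
    have := hA 0 ⟨le_rfl, zero_le_one⟩
    simpa using this
  obtain ⟨t, ht, htB⟩ := intermediate_value_Icc ht₀.le
    (hAc.mono (Icc_subset_Icc_right ht₁)) (show B s ∈ Icc (A 0) (A t₀) from ⟨by linarith, hBA⟩)
  refine ⟨t, ⟨lt_of_le_of_ne ht.1 ?_, ht.2.trans ht₁⟩, s, ⟨hs₀, hs₁⟩, htB⟩
  rintro rfl
  linarith

theorem integral_affine (c m b y : ℝ) :
    ∫ τ in b..y, (c + m * (τ - b)) = c * (y - b) + m * (y - b) ^ 2 / 2 := by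
  have h : ∀ τ ∈ uIcc b y, HasDerivAt (fun τ => c * (τ - b) + m * (τ - b) ^ 2 / 2)
      (c + m * (τ - b)) τ := by
    intro τ _
    have h1 := (hasDerivAt_id τ).sub_const b
    have h2 := (h1.const_mul c).add (((h1.pow 2).const_mul m).div_const 2)
    refine (h2.congr_deriv ?_)
    simp
    ring
  rw [intervalIntegral.integral_eq_sub_of_hasDerivAt h
    (Continuous.intervalIntegrable (by fun_prop) _ _)]
  ring

variable {k : ℝ → ℝ} {S : Set ℝ} {a b y : ℝ}

theorem chord_lt_of_strictConvexOn (hk : StrictConvexOn ℝ S k) (hS : Ici a ⊆ S) (hab : a < b)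
    (hy : b < y) : k b + (k b - k a) / (b - a) * (y - b) < k y := by
  have h := hk.slope_strict_mono_adjacent (hS self_mem_Ici) (hS (hab.trans hy).le) hab hy
  rw [lt_div_iff₀ (by linarith)] at h
  linarith

theorem le_chord_of_strictConvexOn (hk : StrictConvexOn ℝ S k) (hS : Ici a ⊆ S) (hab : a < b)
    (hya : a ≤ y) (hyb : y ≤ b) : k y ≤ k b + (k b - k a) / (b - a) * (y - b) := by
  have hpos : 0 < b - a := sub_pos.2 hab
  have h := hk.convexOn.2 (hS self_mem_Ici) (hS hab.le)
    (show 0 ≤ (b - y) / (b - a) from div_nonneg (by linarith) hpos.le)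
    (show 0 ≤ (y - a) / (b - a) from div_nonneg (by linarith) hpos.le)
    (by rw [← add_div, show b - y + (y - a) = b - a by ring, div_self hpos.ne'])
  simp only [smul_eq_mul] at h
  have e1 : (b - y) / (b - a) * a + (y - a) / (b - a) * b = y := by
    field_simp
    ring
  rw [e1] at h
  refine h.trans (le_of_eq ?_)
  field_simp
  ring

/-- The left side is the integral from `b` to `y` of the chord through `a` and `b`. For `y > b` the
graph lies above the chord; for `a ≤ y ≤ b` it lies below, but the orientation of the integral is
reversed. -/
theorem le_integral_of_strictConvexOn (hkc : Continuous k) (hk : StrictConvexOn ℝ S k)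
    (hS : Ici a ⊆ S) (hab : a < b) (hya : a ≤ y) :
    k b * (y - b) + (k b - k a) / (b - a) * (y - b) ^ 2 / 2 ≤ ∫ τ in b..y, k τ := by
  rw [← integral_affine]
  rcases le_total b y with h | h
  · refine intervalIntegral.integral_mono_on h (Continuous.intervalIntegrable (by fun_prop) _ _)
      (hkc.intervalIntegrable _ _) fun τ hτ => ?_
    rcases hτ.1.eq_or_lt with h' | h'
    · simp [← h']
    · exact (chord_lt_of_strictConvexOn hk hS hab h').le
  · rw [intervalIntegral.integral_symm y b, intervalIntegral.integral_symm y b, neg_le_neg_iff]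
    refine intervalIntegral.integral_mono_on h (hkc.intervalIntegrable _ _)
      (Continuous.intervalIntegrable (by fun_prop) _ _) fun τ hτ => ?_
    exact le_chord_of_strictConvexOn hk hS hab (hya.trans hτ.1) hτ.2

theorem lt_integral_of_strictConvexOn (hkc : Continuous k) (hk : StrictConvexOn ℝ S k)
    (hS : Ici a ⊆ S) (hab : a < b) (hy : b < y) :
    k b * (y - b) + (k b - k a) / (b - a) * (y - b) ^ 2 / 2 < ∫ τ in b..y, k τ := by
  rw [← integral_affine]
  refine intervalIntegral.integral_lt_integral_of_continuousOn_of_le_of_exists_lt hy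
    (by fun_prop) hkc.continuousOn (fun τ hτ => (chord_lt_of_strictConvexOn hk hS hab hτ.1).le)
    ⟨y, right_mem_Icc.2 hy.le, chord_lt_of_strictConvexOn hk hS hab hy⟩

end RealLemmas

/-! ### Energy and constraint along perturbations -/

section Comparison

variable {N : ℕ} {Ω : Set (E N)} {f g h : E N → ℝ → ℝ} {u v w z : E N → ℝ}
  {U V W Z : E N → E N} {M D : ℝ}

theorem integral_pos_of_isOpen {O : Set (E N)} (hO : IsOpen O) (hne : O.Nonempty) (hOΩ : O ⊆ Ω)
    {R : E N → ℝ} (hR : Integrable R (volume.restrict Ω))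
    (h0 : ∀ᵐ x ∂volume.restrict Ω, 0 ≤ R x) (h1 : ∀ᵐ x ∂volume.restrict Ω, x ∈ O → 0 < R x) :
    0 < ∫ x in Ω, R x := by
  rw [integral_pos_iff_support_of_nonneg_ae h0 hR]
  have h2 : 0 < volume.restrict Ω O := by
    rw [Measure.restrict_apply hO.measurableSet, inter_eq_left.2 hOΩ]
    exact hO.measure_pos volume hne
  refine h2.trans_le (measure_mono_ae ?_)
  filter_upwards [h1] with x hx hxO
  exact (hx hxO).ne'

variable [IsFiniteMeasure ((volume : Measure (E N)).restrict Ω)]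

theorem energy_add_const_mul {lam : ℝ} (hΩ : IsOpen Ω) (hu : SobolevPair Ω u U)
    (hf : IsLocallyControlled Ω f) (hg : IsLocallyControlled Ω g) (hM : 0 < M)
    (hb : IsBoundedOn Ω M u) :
    energy Ω (fun x t => f x t + lam * g x t) u =
      energy Ω f u - lam * ∫ x in Ω, primitive g x (u x) := by
  rw [hu.energy_eq hΩ hf hM hb, hu.energy_eq hΩ (hf.add_const_mul hg lam) hM hb]
  have : ∫ x in Ω, primitive (fun x t => f x t + lam * g x t) x (u x) =
      (∫ x in Ω, primitive f x (u x)) + lam * ∫ x in Ω, primitive g x (u x) := by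
    rw [← integral_const_mul, ← integral_add (hf.integrable_primitive hM hb)
      ((hg.integrable_primitive hM hb).const_mul lam)]
    refine integral_congr_ae ?_
    filter_upwards [hf.1.2, hg.1.2] with x h1 h2
    exact primitive_add_const_mul h1 h2 _ _
  rw [this]
  ring

theorem integral_primitive_add_disjoint (hf : IsLocallyControlled Ω f) (hM : 0 < M)
    (hb : IsBoundedOn Ω M u) (hv : IsBoundedOn Ω M (fun x => u x + v x))
    (hw : IsBoundedOn Ω M (fun x => u x + w x)) (hvw : ∀ x, v x = 0 ∨ w x = 0) :
    (∫ x in Ω, primitive f x (u x + (v x + w x))) - ∫ x in Ω, primitive f x (u x) =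
      ((∫ x in Ω, primitive f x (u x + v x)) - ∫ x in Ω, primitive f x (u x)) +
      ((∫ x in Ω, primitive f x (u x + w x)) - ∫ x in Ω, primitive f x (u x)) := by
  have i0 := hf.integrable_primitive hM hb
  have i1 := hf.integrable_primitive hM hv
  have i2 := hf.integrable_primitive hM hw
  have : ∫ x in Ω, primitive f x (u x + (v x + w x)) =
      ∫ x in Ω, ((primitive f x (u x + v x) - primitive f x (u x)) + primitive f x (u x + w x)) := by
    refine integral_congr_ae (ae_of_all _ fun x => ?_)
    rcases hvw x with h | h <;> simp [h]
  have i3 : Integrable (fun x => primitive f x (u x + v x) - primitive f x (u x))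
    (volume.restrict Ω) := i1.sub i0
  rw [this, integral_add i3 i2, integral_sub i1 i0]
  ring

/-- No interaction terms arise: at each point one of the two perturbations vanishes, and likewise
for the gradients. -/
theorem energy_add_disjoint (hΩ : IsOpen Ω) (hu : SobolevPair Ω u U) (hv : SobolevPair Ω v V)
    (hw : SobolevPair Ω w W) (hf : IsLocallyControlled Ω f) (hM : 0 < M)
    (hb : IsBoundedOn Ω M u) (hbv : IsBoundedOn Ω M (fun x => u x + v x))
    (hbw : IsBoundedOn Ω M (fun x => u x + w x))
    (hbvw : IsBoundedOn Ω M (fun x => u x + (v x + w x))) (hvw : ∀ x, v x = 0 ∨ w x = 0)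
    (hVW : ∀ x, V x = 0 ∨ W x = 0) :
    energy Ω f (fun x => u x + (v x + w x)) - energy Ω f u =
      (energy Ω f (fun x => u x + v x) - energy Ω f u) +
      (energy Ω f (fun x => u x + w x) - energy Ω f u) := by
  rw [hu.energy_add hΩ hv hf hM hb hbv, hu.energy_add hΩ hw hf hM hb hbw,
    hu.energy_add hΩ (hv.add hw) hf hM hb hbvw,
    integral_primitive_add_disjoint hf hM hb hbv hbw hvw]
  have e1 : ∫ x in Ω, inner ℝ (U x) (V x + W x) =
      (∫ x in Ω, inner ℝ (U x) (V x)) + ∫ x in Ω, inner ℝ (U x) (W x) := by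
    rw [← integral_add (integrable_inner hu.memLp_grad hv.memLp_grad)
      (integrable_inner hu.memLp_grad hw.memLp_grad)]
    simp_rw [inner_add_right]
  have e2 : ∫ x in Ω, ‖V x + W x‖ ^ 2 = (∫ x in Ω, ‖V x‖ ^ 2) + ∫ x in Ω, ‖W x‖ ^ 2 := by
    rw [← integral_add (integrable_sq_norm hv.memLp_grad) (integrable_sq_norm hw.memLp_grad)]
    refine integral_congr_ae (ae_of_all _ fun x => ?_)
    rcases hVW x with h | h <;> simp [h]
  rw [e1, e2]
  ring

theorem exists_expansion_integral_primitive (hg : IsLocallyControlled Ω g) (hM : 0 < M)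
    (hb : IsBoundedOn Ω M u) (hD : 0 < D) (hz0 : AEStronglyMeasurable z (volume.restrict Ω))
    (hz : ∀ᵐ x ∂volume.restrict Ω, |z x| ≤ D) :
    ∃ K, 0 < K ∧
      (∀ t ∈ Icc (-1 : ℝ) 1, |(∫ x in Ω, primitive g x (u x + t * z x))
        - (∫ x in Ω, primitive g x (u x)) - t * ∫ x in Ω, g x (u x) * z x| ≤ K * t ^ 2) ∧
      ContinuousOn (fun t => ∫ x in Ω, primitive g x (u x + t * z x)) (Icc (-1) 1) := by
  have hM' : 0 < M + D := by positivity
  obtain ⟨C, hC, hT⟩ := hg.exists_taylor_bound hM'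
  have hzb : IsBoundedOn Ω D z := ⟨hz0, hz.mono fun x hx => abs_le.1 hx⟩
  have hb0 : IsBoundedOn Ω (M + D) u := hb.mono (by linarith)
  have hbt : ∀ t ∈ Icc (-1 : ℝ) 1, IsBoundedOn Ω (M + D) (fun x => u x + t * z x) := by
    intro t ht
    refine hb.add ((hzb.const_mul t).mono ?_)
    have := mul_le_mul_of_nonneg_right (abs_le.2 ht) hD.le
    linarith
  refine ⟨C * D ^ 2, by positivity, fun t ht => ?_, ?_⟩
  · have h1 := (hT u _ (|t| * D) (by positivity) hb0 (hbt t ht) (by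
      filter_upwards [hz] with x hx
      rw [add_sub_cancel_left, abs_mul]
      gcongr)).2
    simp only [add_sub_cancel_left] at h1
    have e : ∫ x in Ω, g x (u x) * (t * z x) = t * ∫ x in Ω, g x (u x) * z x := by
      rw [← integral_const_mul]
      refine integral_congr_ae (ae_of_all _ fun x => ?_)
      ring
    rw [e, mul_pow, sq_abs] at h1
    linarith
  · have : LipschitzOnWith (Real.toNNReal (C * D))
        (fun t => ∫ x in Ω, primitive g x (u x + t * z x)) (Icc (-1) 1) := by
      refine LipschitzOnWith.of_dist_le_mul fun t ht t' ht' => ?_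
      rw [Real.coe_toNNReal _ (by positivity), Real.dist_eq, Real.dist_eq]
      have h1 := (hT _ _ (|t - t'| * D) (by positivity) (hbt t' ht') (hbt t ht) (by
        filter_upwards [hz] with x hx
        have : u x + t * z x - (u x + t' * z x) = (t - t') * z x := by ring
        rw [this, abs_mul]
        gcongr)).1
      linarith
    exact this.continuousOn

/-- The Dirichlet terms are traded for integrals in `h` by `hweak` and `hZ`, so the sign of the
energy change becomes a pointwise question. In the application `w` is the reflection of `u`. -/
theorem energy_add_const_mul_eq (hΩ : IsOpen Ω) (hu : SobolevPair Ω u U) (hz : SobolevPair Ω z Z)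
    (hh : IsLocallyControlled Ω h) (hM : 0 < M) (hb : IsBoundedOn Ω M u)
    (hb' : IsBoundedOn Ω M w) {t : ℝ} (hbt : IsBoundedOn Ω M (fun x => u x + t * z x))
    (hweak : ∫ x in Ω, inner ℝ (U x) (Z x) = ∫ x in Ω, h x (u x) * z x)
    (hZ : ∫ x in Ω, ‖Z x‖ ^ 2 = ∫ x in Ω, (h x (u x) - h x (w x)) * z x) :
    Integrable (fun x => primitive h x (u x + t * z x) - primitive h x (u x)
      - (t * (h x (u x) * z x) + t ^ 2 / 2 * ((h x (u x) - h x (w x)) * z x)))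
      (volume.restrict Ω) ∧
    energy Ω h (fun x => u x + t * z x) - energy Ω h u =
      -∫ x in Ω, (primitive h x (u x + t * z x) - primitive h x (u x)
        - (t * (h x (u x) * z x) + t ^ 2 / 2 * ((h x (u x) - h x (w x)) * z x))) := by
  have i1 := hh.integrable_primitive hM hbt
  have i2 := hh.integrable_primitive hM hb
  have i3 := (integrable_mul_of_memLp (hh.memLp_comp hM hb) hz.memLp).const_mul t
  have i4 : Integrable (fun x => t ^ 2 / 2 * ((h x (u x) - h x (w x)) * z x))
      (volume.restrict Ω) :=
    (integrable_mul_of_memLp ((hh.memLp_comp hM hb).sub (hh.memLp_comp hM hb'))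
      hz.memLp).const_mul (t ^ 2 / 2)
  have i12 : Integrable (fun x => primitive h x (u x + t * z x) - primitive h x (u x))
    (volume.restrict Ω) := i1.sub i2
  have i34 : Integrable (fun x => t * (h x (u x) * z x)
    + t ^ 2 / 2 * ((h x (u x) - h x (w x)) * z x)) (volume.restrict Ω) := i3.add i4
  refine ⟨i12.sub i34, ?_⟩
  rw [hu.energy_add hΩ (hz.const_mul t) hh hM hb hbt, integral_sub i12 i34, integral_sub i1 i2,
    integral_add i3 i4, integral_const_mul, integral_const_mul, ← hweak, ← hZ]
  have e1 : ∫ x in Ω, inner ℝ (U x) (t • Z x) = t * ∫ x in Ω, inner ℝ (U x) (Z x) := by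
    rw [← integral_const_mul]
    simp_rw [inner_smul_right]
  have e2 : ∫ x in Ω, ‖t • Z x‖ ^ 2 = t ^ 2 * ∫ x in Ω, ‖Z x‖ ^ 2 := by
    rw [← integral_const_mul]
    simp_rw [norm_smul, mul_pow, Real.norm_eq_abs, sq_abs]
  rw [e1, e2]
  ring

end Comparison


/-! ### Reflections and the two-sided comparison -/

section Reflection

variable {N : ℕ} {Ω : Set (E N)} {f g h : E N → ℝ → ℝ} {u : E N → ℝ}
  {U : E N → E N} {e : E N} {σ : E N ≃ₗᵢ[ℝ] E N} {M : ℝ} {S : Set ℝ}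

/-- `σ` is the reflection in the hyperplane orthogonal to `e`. -/
structure IsReflection (e : E N) (σ : E N ≃ₗᵢ[ℝ] E N) : Prop where
  involutive : ∀ x, σ (σ x) = x
  inner_map : ∀ x, inner ℝ (σ x) e = -inner ℝ x e
  fixed : ∀ x, inner ℝ x e = 0 → σ x = x

theorem isReflection_reflection (e : E N) : IsReflection e (ℝ ∙ e)ᗮ.reflection where
  involutive := Submodule.reflection_reflection _
  inner_map x := by
    have h := (ℝ ∙ e)ᗮ.reflection.inner_map_map x e
    rw [Submodule.reflection_orthogonalComplement_singleton_eq_neg, inner_neg_right] at h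
    linarith
  fixed x hx := Submodule.reflection_mem_subspace_eq_self
    (Submodule.mem_orthogonal_singleton_iff_inner_left.2 hx)

theorem IsReflection.neg (hσ : IsReflection e σ) : IsReflection (-e) σ where
  involutive := hσ.involutive
  inner_map x := by simp [hσ.inner_map]
  fixed x hx := hσ.fixed x (by simpa using hx)

theorem IsReflection.symm_apply (hσ : IsReflection e σ) (x : E N) : σ.symm x = σ x := by
  rw [σ.symm_apply_eq, hσ.involutive]

/-- The positive part of `u - u ∘ σ` on the half-space determined by `e`, extended by zero. -/
def excess (e : E N) (σ : E N ≃ₗᵢ[ℝ] E N) (u : E N → ℝ) : E N → ℝ :=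
  (halfSpace e).indicator fun x => max (u x - u (σ x)) 0

/-- The weak gradient of `excess e σ u` if `U` is that of `u`. -/
def excessGradient (e : E N) (σ : E N ≃ₗᵢ[ℝ] E N) (u : E N → ℝ) (U : E N → E N) : E N → E N :=
  (halfSpace e ∩ {x | 0 < u x - u (σ x)}).indicator fun x => U x - σ.symm (U (σ x))

theorem excess_nonneg (x : E N) : 0 ≤ excess e σ u x :=
  indicator_nonneg (fun _ _ => le_max_right _ _) x

theorem excess_eq_of_ne_zero {x : E N} (hx : excess e σ u x ≠ 0) :
    excess e σ u x = u x - u (σ x) ∧ 0 < u x - u (σ x) := by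
  have h1 : x ∈ halfSpace e := by
    by_contra h
    exact hx (indicator_of_notMem h _)
  rw [excess, indicator_of_mem h1] at hx ⊢
  have h2 : 0 < u x - u (σ x) := by
    by_contra h
    exact hx (max_eq_right (not_lt.1 h))
  exact ⟨max_eq_left h2.le, h2⟩

/-- If `φ n` approximates `u`, then `φ n - φ n ∘ σ` approximates `u - u ∘ σ` and vanishes on the
hyperplane, as the cutoff requires. -/
theorem sobolevPair_excess (hσ : IsReflection e σ) (hΩσ : ∀ x, σ x ∈ Ω ↔ x ∈ Ω)
    (hu : SobolevPair Ω u U) : SobolevPair Ω (excess e σ u) (excessGradient e σ u U) := by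
  have hp := hu.add ((hu.comp_isometry σ hΩσ).const_mul (-1))
  simp only [neg_mul, one_mul, ← sub_eq_add_neg, neg_smul, one_smul] at hp
  obtain ⟨φ, h1, h2, h3⟩ := hu.approx
  have hP := measurePreserving_restrict σ hΩσ
  have hm := hu.comp_isometry σ hΩσ
  have hφσ : ∀ n, SobolevPair Ω (fun x => φ n (σ x)) (fun x => σ.symm (gradient (φ n) (σ x))) :=
    fun n => (h1 n).sobolevPair.comp_isometry σ hΩσ
  refine sobolevPair_indicator_posPart hp.memLp hp.memLp_grad
    (φ := fun n x => φ n x + (-1) * φ n (σ x))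
    (fun n => (h1 n).add (((h1 n).comp_isometry σ hΩσ).const_mul (-1)))
    (fun n x hx => by simp [hσ.fixed x hx]) ?_ ?_
  · have h4 : Tendsto (fun n => eLpNorm (fun x => φ n (σ x) - u (σ x)) 2 (volume.restrict Ω))
        atTop (𝓝 0) := h2.congr fun n =>
      (eLpNorm_comp_measurePreserving ((h1 n).memLp.1.sub hu.memLp.1) hP).symm
    have := tendsto_eLpNorm_add (fun n => (h1 n).memLp) hu.memLp
      (fun n => ((hφσ n).const_mul (-1)).memLp) (hm.const_mul (-1)).memLp h2
      (tendsto_eLpNorm_const_smul (-1) h4)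
    simpa only [neg_mul, one_mul, ← sub_eq_add_neg] using this
  · have h4 : Tendsto (fun n => eLpNorm (fun x => σ.symm (gradient (φ n) (σ x)) -
        σ.symm (U (σ x))) 2 (volume.restrict Ω)) atTop (𝓝 0) := by
      refine h3.congr fun n => ?_
      refine (eLpNorm_comp_measurePreserving ((h1 n).memLp_gradient.1.sub hu.memLp_grad.1)
        hP).symm.trans ?_
      refine eLpNorm_congr_norm_ae (ae_of_all _ fun x => ?_)
      rw [← map_sub, σ.symm.norm_map]
      rfl
    have := tendsto_eLpNorm_add (fun n => (h1 n).memLp_gradient) hu.memLp_grad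
      (fun n => ((hφσ n).const_mul (-1)).memLp_grad) (hm.const_mul (-1)).memLp_grad h3
      (tendsto_eLpNorm_const_smul (-1) h4)
    have hg : ∀ n x, gradient (fun x => φ n x + -1 * φ n (σ x)) x =
        gradient (φ n) x + (-1 : ℝ) • σ.symm (gradient (φ n) (σ x)) := by
      intro n x
      rw [gradient_add (h1 n).differentiable
        (((h1 n).comp_isometry σ hΩσ).const_mul (-1)).differentiable,
        gradient_const_mul ((h1 n).comp_isometry σ hΩσ).differentiable,
        gradient_comp_isometry (h1 n).differentiable]
    simp only [neg_smul, one_smul, ← sub_eq_add_neg] at this hg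
    simp only [hg]
    exact this

theorem isBoundedOn_excess (hσ : IsReflection e σ) (hΩσ : ∀ x, σ x ∈ Ω ↔ x ∈ Ω) (hΩ : IsOpen Ω)
    (hu : SobolevPair Ω u U) (hM : ∀ x ∈ Ω, |u x| ≤ M) :
    IsBoundedOn Ω (2 * M) (excess e σ u) := by
  refine ⟨(sobolevPair_excess hσ hΩσ hu).memLp.1, ?_⟩
  filter_upwards [ae_restrict_mem hΩ.measurableSet] with x hx
  have h1 := abs_le.1 (hM x hx)
  have h2 := abs_le.1 (hM (σ x) ((hΩσ x).2 hx))
  by_cases h0 : excess e σ u x = 0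
  · rw [h0]
    exact ⟨by linarith [h1.1, h1.2], by linarith [h1.1, h1.2]⟩
  · obtain ⟨h3, h4⟩ := excess_eq_of_ne_zero h0
    rw [h3]
    exact ⟨by linarith [h1.1, h1.2], by linarith [h1.2, h2.1]⟩

theorem integral_mul_excess_pos (hΩ : IsOpen Ω) (hσ : IsReflection e σ)
    (hΩσ : ∀ x, σ x ∈ Ω ↔ x ∈ Ω) (hu : SobolevPair Ω u U) (huc : ContinuousOn u Ω)
    {k : E N → ℝ} (hk : MemLp k 2 (volume.restrict Ω)) (hpos : ∀ᵐ x ∂volume.restrict Ω, 0 < k x)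
    (hne : ∃ x ∈ Ω, x ∈ halfSpace e ∧ u (σ x) < u x) :
    0 < ∫ x in Ω, k x * excess e σ u x := by
  obtain ⟨x₀, hx₀, hx₁, hx₂⟩ := hne
  have hσc : ContinuousOn (fun x => u (σ x)) Ω :=
    huc.comp σ.continuous.continuousOn fun x hx => (hΩσ x).2 hx
  have h1 : IsOpen (Ω ∩ {x | u (σ x) < u x}) := by
    have := (huc.sub hσc).isOpen_inter_preimage hΩ (isOpen_Ioi (a := (0 : ℝ)))
    convert this using 1
    ext x
    simp
  refine integral_pos_of_isOpen (h1.inter (isOpen_halfSpace e)) ⟨x₀, ⟨hx₀, hx₂⟩, hx₁⟩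
    (inter_subset_left.trans inter_subset_left)
    (integrable_mul_of_memLp hk (sobolevPair_excess hσ hΩσ hu).memLp) ?_ ?_
  · filter_upwards [hpos] with x hx using mul_nonneg hx.le (excess_nonneg x)
  · filter_upwards [hpos] with x hx
    rintro ⟨⟨-, hxu⟩, hxe⟩
    refine mul_pos hx ?_
    rw [excess, indicator_of_mem hxe]
    exact lt_max_of_lt_left (sub_pos.2 hxu)

variable [IsFiniteMeasure ((volume : Measure (E N)).restrict Ω)]

/-- Test the equation with the excess `z` and with `z ∘ σ`, move the second identity by `σ` using
that `h` is radial, and subtract. On the set where its gradient `Z` may be nonzero, `Z` equals the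
gradient of `u - u ∘ σ`, so the pairing is `‖Z‖²`. -/
theorem integral_sq_norm_excessGradient (hΩ : IsOpen Ω) (hσ : IsReflection e σ)
    (hΩσ : ∀ x, σ x ∈ Ω ↔ x ∈ Ω) (hu : SobolevPair Ω u U) (hh : IsLocallyControlled Ω h)
    (hrad : IsRadial Ω h) (hM : 0 < M) (hb : IsBoundedOn Ω M u)
    (hbσ : IsBoundedOn Ω M (fun x => u (σ x)))
    (hweak : ∀ φ, IsTestFunction Ω φ → ∫ x in Ω, inner ℝ (U x) (gradient φ x) =
      ∫ x in Ω, h x (u x) * φ x) :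
    ∫ x in Ω, ‖excessGradient e σ u U x‖ ^ 2 =
      ∫ x in Ω, (h x (u x) - h x (u (σ x))) * excess e σ u x := by
  have hz := sobolevPair_excess hσ hΩσ hu
  set z := excess e σ u
  set Z := excessGradient e σ u U with hZ
  have hk := hh.memLp_comp hM hb
  have h1 := hu.integral_inner_eq hk hweak hz
  have h2 := hu.integral_inner_eq hk hweak (hz.comp_isometry σ hΩσ)
  rw [← integral_comp_isometry σ hΩσ, ← integral_comp_isometry (F := ℝ) σ hΩσ
    (fun x => h x (u x) * z (σ x))] at h2
  simp only [hσ.involutive] at h2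
  have h3 : ∫ x in Ω, h (σ x) (u (σ x)) * z x = ∫ x in Ω, h x (u (σ x)) * z x := by
    refine setIntegral_congr_fun hΩ.measurableSet fun x hx => ?_
    rw [hrad _ (σ x) ((hΩσ x).2 hx) x hx (σ.norm_map x)]
  have h4 : ∀ x, inner ℝ (U (σ x)) (σ.symm (Z x)) = inner ℝ (σ.symm (U (σ x))) (Z x) := by
    intro x
    rw [← σ.inner_map_map, σ.apply_symm_apply, hσ.symm_apply]
  simp_rw [h4] at h2
  have hkσ := hh.memLp_comp hM hbσ
  rw [h3] at h2
  have e1 : ∫ x in Ω, (h x (u x) - h x (u (σ x))) * z x =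
      (∫ x in Ω, h x (u x) * z x) - ∫ x in Ω, h x (u (σ x)) * z x := by
    rw [← integral_sub (integrable_mul_of_memLp hk hz.memLp)
      (integrable_mul_of_memLp hkσ hz.memLp)]
    simp_rw [sub_mul]
  have e2 : ∫ x in Ω, ‖Z x‖ ^ 2 =
      (∫ x in Ω, inner ℝ (U x) (Z x)) - ∫ x in Ω, inner ℝ (σ.symm (U (σ x))) (Z x) := by
    rw [← integral_sub (integrable_inner hu.memLp_grad hz.memLp_grad)
      (integrable_inner (hu.comp_isometry σ hΩσ).memLp_grad hz.memLp_grad)]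
    refine integral_congr_ae (ae_of_all _ fun x => ?_)
    simp only
    rw [← inner_sub_left]
    by_cases hx : x ∈ halfSpace e ∩ {x | 0 < u x - u (σ x)}
    · rw [hZ, excessGradient, indicator_of_mem hx, real_inner_self_eq_norm_sq]
    · rw [hZ, excessGradient, indicator_of_notMem hx]
      simp
  rw [e1, e2, h1, h2]

/-- The pointwise chord comparison with `a = u (σ x)`, `b = u x` and `y = b + t (b - a)`. The
condition `t ≥ -1` is exactly `y ≥ a`; `t > 0` is `y > b`, where the comparison is strict on a
nonempty open set. -/
theorem energy_add_excess (hΩ : IsOpen Ω) (hσ : IsReflection e σ)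
    (hΩσ : ∀ x, σ x ∈ Ω ↔ x ∈ Ω) (hu : SobolevPair Ω u U) (huc : ContinuousOn u Ω)
    (hh : IsLocallyControlled Ω h) (hrad : IsRadial Ω h) (hM : 0 < M) (hb : ∀ x ∈ Ω, |u x| ≤ M)
    (hweak : ∀ φ, IsTestFunction Ω φ → ∫ x in Ω, inner ℝ (U x) (gradient φ x) =
      ∫ x in Ω, h x (u x) * φ x)
    (hS : ∀ x ∈ Ω, Ici (u x) ⊆ S) (hconv : ∀ᵐ x ∂volume.restrict Ω, StrictConvexOn ℝ S (h x))
    {t : ℝ} (ht : t ∈ Icc (-1 : ℝ) 1) :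
    energy Ω h (fun x => u x + t * excess e σ u x) ≤ energy Ω h u ∧
    (0 < t → (∃ x ∈ Ω, x ∈ halfSpace e ∧ u (σ x) < u x) →
      energy Ω h (fun x => u x + t * excess e σ u x) < energy Ω h u) := by
  have hz := sobolevPair_excess hσ hΩσ hu
  have hσc : ContinuousOn (fun x => u (σ x)) Ω :=
    huc.comp σ.continuous.continuousOn fun x hx => (hΩσ x).2 hx
  have hbu : IsBoundedOn Ω M u := isBoundedOn_of_continuousOn hΩ huc hb
  have hbσ : IsBoundedOn Ω M (fun x => u (σ x)) :=
    isBoundedOn_of_continuousOn hΩ hσc fun x hx => hb _ ((hΩσ x).2 hx)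
  have hM3 : 0 < M + 2 * M := by positivity
  have hbt : IsBoundedOn Ω (M + 2 * M) (fun x => u x + t * excess e σ u x) := by
    refine hbu.add (((isBoundedOn_excess hσ hΩσ hΩ hu hb).const_mul t).mono ?_)
    have := mul_le_mul_of_nonneg_right (abs_le.2 ht) (by positivity : 0 ≤ 2 * M)
    linarith
  obtain ⟨hint, heq⟩ := energy_add_const_mul_eq hΩ hu hz hh hM3 (hbu.mono (by linarith))
    (hbσ.mono (by linarith)) hbt (hu.integral_inner_eq (hh.memLp_comp hM hbu) hweak hz)
    (integral_sq_norm_excessGradient hΩ hσ hΩσ hu hh hrad hM hbu hbσ hweak)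
  -- Identifies the integral of the chord with the linear and quadratic terms of the energy
  -- expansion.
  have hpt : ∀ a b k₁ k₂ : ℝ, 0 < b - a →
      k₁ * (b + t * (b - a) - b) + (k₁ - k₂) / (b - a) * (b + t * (b - a) - b) ^ 2 / 2 =
        t * (k₁ * (b - a)) + t ^ 2 / 2 * ((k₁ - k₂) * (b - a)) := by
    intro a b k₁ k₂ hab
    have := hab.ne'
    field_simp
    ring
  have hnonneg : ∀ᵐ x ∂volume.restrict Ω, 0 ≤ primitive h x (u x + t * excess e σ u x)
      - primitive h x (u x) - (t * (h x (u x) * excess e σ u x)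
        + t ^ 2 / 2 * ((h x (u x) - h x (u (σ x))) * excess e σ u x)) := by
    filter_upwards [hconv, hh.1.2, ae_restrict_mem hΩ.measurableSet] with x h1 h2 hx
    by_cases h0 : excess e σ u x = 0
    · simp [h0]
    · obtain ⟨h3, h4⟩ := excess_eq_of_ne_zero h0
      rw [h3, primitive_sub h2, sub_nonneg]
      have := le_integral_of_strictConvexOn h2 h1 (hS (σ x) ((hΩσ x).2 hx))
        (sub_pos.1 h4) (y := u x + t * (u x - u (σ x))) (by nlinarith [ht.1])
      rwa [hpt _ _ _ _ h4] at this
  constructor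
  · have := integral_nonneg_of_ae hnonneg
    linarith
  · rintro ht0 ⟨x₀, hx₀, hx₁, hx₂⟩
    have hO : IsOpen (Ω ∩ (halfSpace e ∩ {x | u (σ x) < u x}) : Set (E N)) := by
      have h1 : IsOpen (Ω ∩ {x | u (σ x) < u x}) := by
        have := (huc.sub hσc).isOpen_inter_preimage hΩ (isOpen_Ioi (a := (0 : ℝ)))
        convert this using 1
        ext x
        simp
      have := h1.inter (isOpen_halfSpace e)
      convert this using 1
      ext x
      simp only [mem_inter_iff]
      tauto
    have hpos := integral_pos_of_isOpen hO ⟨x₀, hx₀, hx₁, hx₂⟩ inter_subset_left hint hnonneg (by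
      filter_upwards [hconv, hh.1.2] with x h1 h2 hx
      obtain ⟨hxΩ, hxe, hxu⟩ := hx
      simp only [mem_ofPred_eq] at hxu
      have h4 : 0 < u x - u (σ x) := sub_pos.2 hxu
      have h3 : excess e σ u x = u x - u (σ x) := by
        rw [excess, indicator_of_mem hxe, max_eq_left h4.le]
      rw [h3, primitive_sub h2, sub_pos]
      have := lt_integral_of_strictConvexOn h2 h1 (hS (σ x) ((hΩσ x).2 hxΩ)) hxu
        (y := u x + t * (u x - u (σ x))) (by nlinarith)
      rwa [hpt _ _ _ _ h4] at this)
    linarith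

theorem excess_eq_zero_or (x : E N) : excess e σ u x = 0 ∨ excess (-e) σ u x = 0 := by
  by_cases hx : x ∈ halfSpace e
  · right
    refine indicator_of_notMem (fun h' => ?_) _
    have h1 : 0 < inner ℝ x e := hx
    have h2 : 0 < inner ℝ x (-e) := h'
    rw [inner_neg_right] at h2
    linarith
  · exact Or.inl (indicator_of_notMem hx _)

theorem excessGradient_eq_zero_or (x : E N) :
    excessGradient e σ u U x = 0 ∨ excessGradient (-e) σ u U x = 0 := by
  by_cases hx : x ∈ halfSpace e
  · right
    refine indicator_of_notMem (fun h' => ?_) _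
    have h1 : 0 < inner ℝ x e := hx
    have h2 : 0 < inner ℝ x (-e) := h'.1
    rw [inner_neg_right] at h2
    linarith
  · exact Or.inl (indicator_of_notMem (fun h' => hx h'.1) _)

/-- Add a multiple of the excess on one side and subtract one on the other, balanced to stay on the
constraint. The energy for `f + lam * g` strictly drops from the first change and does not rise from
the second. -/
theorem not_exists_lt_both_sides (hΩ : IsOpen Ω) (hσ : IsReflection e σ)
    (hΩσ : ∀ x, σ x ∈ Ω ↔ x ∈ Ω) (hu : SobolevPair Ω u U) (huc : ContinuousOn u Ω)
    (hf : IsLocallyControlled Ω f) (hg : IsLocallyControlled Ω g) {lam : ℝ}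
    (hrad : IsRadial Ω (fun x t => f x t + lam * g x t)) (hM : 0 < M) (hb : ∀ x ∈ Ω, |u x| ≤ M)
    (hweak : ∀ φ, IsTestFunction Ω φ → ∫ x in Ω, inner ℝ (U x) (gradient φ x) =
      ∫ x in Ω, (f x (u x) + lam * g x (u x)) * φ x)
    (hS : ∀ x ∈ Ω, Ici (u x) ⊆ S)
    (hconv : ∀ᵐ x ∂volume.restrict Ω, StrictConvexOn ℝ S (fun t => f x t + lam * g x t))
    (hcon : ∫ x in Ω, primitive g x (u x) = 1)
    (hmin : ∀ w ∈ constraintSet Ω g, energy Ω f u ≤ energy Ω f w)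
    {κ : ℝ} (hκ : ∀ᵐ x ∂volume.restrict Ω, 0 < κ * g x (u x))
    (hne : ∃ x ∈ Ω, x ∈ halfSpace e ∧ u (σ x) < u x)
    (hne' : ∃ x ∈ Ω, x ∈ halfSpace (-e) ∧ u (σ x) < u x) : False := by
  have hbu : IsBoundedOn Ω M u := isBoundedOn_of_continuousOn hΩ huc hb
  have hz₁ := sobolevPair_excess hσ hΩσ hu
  have hz₂ := sobolevPair_excess hσ.neg hΩσ hu
  have hb₁ := isBoundedOn_excess hσ hΩσ hΩ hu hb
  have hb₂ := isBoundedOn_excess hσ.neg hΩσ hΩ hu hb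
  have hM2 : 0 < 2 * M := by positivity
  have ig := hg.memLp_comp hM hbu
  have ha₁ := integral_mul_excess_pos hΩ hσ hΩσ hu huc (ig.const_mul κ) hκ hne
  have ha₂ := integral_mul_excess_pos hΩ hσ.neg hΩσ hu huc (ig.const_mul κ) hκ hne'
  have hE₁ := fun t ht => energy_add_excess (t := t) hΩ hσ hΩσ hu huc (hf.add_const_mul hg lam)
    hrad hM hb hweak hS hconv ht
  have hE₂ := fun t ht => energy_add_excess (t := t) hΩ hσ.neg hΩσ hu huc (hf.add_const_mul hg lam)
    hrad hM hb hweak hS hconv ht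
  have hdis := fun x => excess_eq_zero_or (e := e) (σ := σ) (u := u) x
  have hdisG := fun x => excessGradient_eq_zero_or (e := e) (σ := σ) (u := u) (U := U) x
  set z₁ := excess e σ u
  set z₂ := excess (-e) σ u
  obtain ⟨K₁, hK₁, hx₁, hc₁⟩ := exists_expansion_integral_primitive hg hM hbu hM2
    hb₁.1 (hb₁.2.mono fun x hx => abs_le.2 hx)
  obtain ⟨K₂, hK₂, hx₂, hc₂⟩ := exists_expansion_integral_primitive hg hM hbu hM2
    hb₂.1 (hb₂.2.mono fun x hx => abs_le.2 hx)
  have hκe : ∀ z : E N → ℝ, ∫ x in Ω, κ * g x (u x) * z x = κ * ∫ x in Ω, g x (u x) * z x := by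
    intro z
    rw [← integral_const_mul]
    simp_rw [mul_assoc]
  rw [hκe] at ha₁ ha₂
  have hκ0 : κ ≠ 0 := by
    rintro rfl
    simp at ha₁
  rw [hcon] at hx₁ hx₂
  -- `A` is the gain in the constraint from adding `t z₁`, `B` the loss from subtracting `s z₂`; the
  -- factor `κ` makes both slopes positive whatever the sign of `g`.
  obtain ⟨t, ht, s, hs, hts⟩ := exists_eq_of_expansion
    (A := fun t => κ * ((∫ x in Ω, primitive g x (u x + t * z₁ x)) - 1))
    (B := fun s => κ * (1 - ∫ x in Ω, primitive g x (u x + -s * z₂ x)))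
    (K := |κ| * (K₁ + K₂)) ha₁ ha₂ (by positivity)
    (fun t ht => by
      have h1 := hx₁ t ⟨by linarith [ht.1], ht.2⟩
      rw [show κ * ((∫ x in Ω, primitive g x (u x + t * z₁ x)) - 1)
        - t * (κ * ∫ x in Ω, g x (u x) * z₁ x) =
        κ * ((∫ x in Ω, primitive g x (u x + t * z₁ x)) - 1
          - t * ∫ x in Ω, g x (u x) * z₁ x) by ring, abs_mul, mul_assoc]
      refine mul_le_mul_of_nonneg_left ?_ (abs_nonneg _)
      nlinarith [sq_nonneg t])
    (fun s hs => by
      have h1 := hx₂ (-s) ⟨by linarith [hs.2], by linarith [hs.1]⟩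
      rw [show κ * (1 - ∫ x in Ω, primitive g x (u x + -s * z₂ x))
        - s * (κ * ∫ x in Ω, g x (u x) * z₂ x) =
        -(κ * ((∫ x in Ω, primitive g x (u x + -s * z₂ x)) - 1
          - -s * ∫ x in Ω, g x (u x) * z₂ x)) by ring, abs_neg, abs_mul, mul_assoc]
      refine mul_le_mul_of_nonneg_left ?_ (abs_nonneg _)
      nlinarith [sq_nonneg s])
    (continuousOn_const.mul ((hc₁.mono (Icc_subset_Icc_left (by norm_num))).sub continuousOn_const))
  have hts' := mul_left_cancel₀ hκ0 hts
  have hM5 : 0 < M + 2 * M + 2 * M := by positivity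
  have htI : t ∈ Icc (-1 : ℝ) 1 := ⟨by linarith [ht.1], ht.2⟩
  have hsI : -s ∈ Icc (-1 : ℝ) 1 := ⟨by linarith [hs.2], by linarith [hs.1]⟩
  have hsc : ∀ {r : ℝ}, r ∈ Icc (-1 : ℝ) 1 → |r| * (2 * M) ≤ 2 * M := fun {r} hr => by
    have := mul_le_mul_of_nonneg_right (abs_le.2 hr) hM2.le
    linarith
  have hv := (hb₁.const_mul t).mono (hsc htI)
  have hw := (hb₂.const_mul (-s)).mono (hsc hsI)
  have hbv := (hbu.add hv).mono (show M + 2 * M ≤ M + 2 * M + 2 * M by linarith)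
  have hbw := (hbu.add hw).mono (show M + 2 * M ≤ M + 2 * M + 2 * M by linarith)
  have hbvw := (hbu.add (hv.add hw)).mono
    (show M + (2 * M + 2 * M) ≤ M + 2 * M + 2 * M by linarith)
  have hb0 := hbu.mono (show M ≤ M + 2 * M + 2 * M by linarith)
  have hdis' : ∀ x, t * z₁ x = 0 ∨ -s * z₂ x = 0 := fun x => (hdis x).imp
    (fun h => by rw [h, mul_zero]) (fun h => by rw [h, mul_zero])
  have hG := integral_primitive_add_disjoint hg hM5 hb0 hbv hbw hdis'
  have hcon' : ∫ x in Ω, primitive g x (u x + (t * z₁ x + -s * z₂ x)) = 1 := by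
    rw [hcon] at hG
    linarith
  have hpair := hu.add ((hz₁.const_mul t).add (hz₂.const_mul (-s)))
  have h0 := hmin _ ⟨hpair.memH10 hΩ, hcon'⟩
  have hE := energy_add_disjoint hΩ hu (hz₁.const_mul t) (hz₂.const_mul (-s))
    (hf.add_const_mul hg lam) hM5 hb0 hbv hbw hbvw hdis'
    (fun x => (hdisG x).imp (fun h => by rw [h, smul_zero]) (fun h => by rw [h, smul_zero]))
  have hL1 := energy_add_const_mul (lam := lam) hΩ hpair hf hg hM5 hbvw
  have hL0 := energy_add_const_mul (lam := lam) hΩ hu hf hg hM5 hb0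
  rw [hcon'] at hL1
  rw [hcon] at hL0
  have hs1 := (hE₁ t htI).2 ht.1 hne
  have hs2 := (hE₂ (-s) hsI).1
  linarith

end Reflection

/-! ### From one-sided comparison to axial symmetry -/

section Symmetry

variable {N : ℕ} {Ω : Set (E N)} {u : E N → ℝ}

/-- `(u ∘ σ - u) ⟨x, e⟩` is nonnegative on both sides, since both factors change sign under `σ`. Its
integral is `-2` times the component of the first moment along `e`, that is zero, so by continuity
it vanishes. -/
theorem comp_reflection_eq_of_one_sided (hΩ : IsOpen Ω)
    {e : E N} {σ : E N ≃ₗᵢ[ℝ] E N} (hσ : IsReflection e σ) (hΩσ : ∀ x, σ x ∈ Ω ↔ x ∈ Ω)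
    (huc : ContinuousOn u Ω) (hint : Integrable (fun x => u x • x) (volume.restrict Ω))
    (hm : inner ℝ (∫ x in Ω, u x • x) e = 0)
    (hone : ∀ x ∈ Ω, x ∈ halfSpace e → u x ≤ u (σ x)) : ∀ x ∈ Ω, u (σ x) = u x := by
  have hσc : ContinuousOn (fun x => u (σ x)) Ω :=
    huc.comp σ.continuous.continuousOn fun x hx => (hΩσ x).2 hx
  have i1 : Integrable (fun x => u x * inner ℝ x e) (volume.restrict Ω) := by
    refine (hint.inner_const e).congr (ae_of_all _ fun x => ?_)
    simp [inner_smul_left]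
  have i2 : Integrable (fun x => u (σ x) * inner ℝ x e) (volume.restrict Ω) := by
    have := ((measurePreserving_restrict σ hΩσ).integrable_comp_emb
      σ.toHomeomorph.measurableEmbedding).2 i1
    refine this.neg.congr (ae_of_all _ fun x => ?_)
    simp [Function.comp, hσ.inner_map]
  have h1 : ∫ x in Ω, u x * inner ℝ x e = 0 := by
    rw [← hm, real_inner_comm, ← integral_inner hint]
    refine integral_congr_ae (ae_of_all _ fun x => ?_)
    simp only
    rw [inner_smul_right, real_inner_comm]
  have h2 : ∫ x in Ω, u (σ x) * inner ℝ x e = 0 := by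
    have := integral_comp_isometry σ hΩσ (fun x => u x * inner ℝ x e)
    simp only [hσ.inner_map, mul_neg] at this
    rw [integral_neg, h1] at this
    linarith
  have h3 : ∫ x in Ω, (u (σ x) - u x) * inner ℝ x e = 0 := by
    simp_rw [sub_mul]
    rw [integral_sub i2 i1, h1, h2, sub_zero]
  have i3 : Integrable (fun x => (u (σ x) - u x) * inner ℝ x e) (volume.restrict Ω) := by
    simp_rw [sub_mul]
    exact i2.sub i1
  have hnn : ∀ x ∈ Ω, 0 ≤ (u (σ x) - u x) * inner ℝ x e := by
    intro x hx
    rcases lt_trichotomy (inner ℝ x e) 0 with h | h | h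
    · have h4 := hone (σ x) ((hΩσ x).2 hx) (by
        change 0 < inner ℝ (σ x) e
        rw [hσ.inner_map]
        linarith)
      rw [hσ.involutive] at h4
      exact mul_nonneg_of_nonpos_of_nonpos (by linarith) h.le
    · simp [h]
    · exact mul_nonneg (sub_nonneg.2 (hone x hx h)) h.le
  intro x hx
  by_cases h0 : inner ℝ x e = 0
  · rw [hσ.fixed x h0]
  by_contra hne
  have hc : ContinuousOn (fun x => (u (σ x) - u x) * inner ℝ x e) Ω :=
    (hσc.sub huc).mul (by fun_prop)
  have hO : IsOpen (Ω ∩ (fun x => (u (σ x) - u x) * inner ℝ x e) ⁻¹' Ioi 0) :=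
    hc.isOpen_inter_preimage hΩ isOpen_Ioi
  have hpos := integral_pos_of_isOpen hO
    ⟨x, hx, lt_of_le_of_ne (hnn x hx) (mul_ne_zero (sub_ne_zero.2 hne) h0).symm⟩
    inter_subset_left i3
    ((ae_restrict_mem hΩ.measurableSet).mono fun y hy => hnn y hy)
    (ae_of_all _ fun y hy => hy.2)
  exact hpos.ne' h3

theorem isAxiallySymmetric_of_reflection (hN : 2 ≤ N) (m : E N)
    (h : ∀ e : E N, inner ℝ m e = 0 → ∀ x ∈ Ω, u ((ℝ ∙ e)ᗮ.reflection x) = u x) :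
    IsAxiallySymmetric Ω u := by
  classical
  have hnt : Nontrivial (E N) := by
    have : Nonempty (Fin N) := ⟨⟨0, by omega⟩⟩
    infer_instance
  obtain ⟨ξ, hξ, c, hc⟩ : ∃ ξ : E N, ‖ξ‖ = 1 ∧ ∃ c : ℝ, m = c • ξ := by
    by_cases hm : m = 0
    · obtain ⟨ξ, hξ⟩ := exists_norm_eq (E N) zero_le_one
      exact ⟨ξ, hξ, 0, by simp [hm]⟩
    · have : ‖m‖ ≠ 0 := norm_ne_zero_iff.2 hm
      refine ⟨‖m‖⁻¹ • m, by rw [norm_smul, norm_inv, norm_norm, inv_mul_cancel₀ this], ‖m‖, ?_⟩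
      rw [smul_smul, mul_inv_cancel₀ this, one_smul]
  -- `η` evaluates `u` at some point with the prescribed data; the symmetry shows that the choice
  -- does not matter.
  refine ⟨ξ, hξ, fun r s => if h : ∃ y ∈ Ω, ‖y‖ = r ∧ inner ℝ y ξ = s then u h.choose else 0,
    fun x hx => ?_⟩
  have hex : ∃ y ∈ Ω, ‖y‖ = ‖x‖ ∧ inner ℝ y ξ = inner ℝ x ξ := ⟨x, hx, rfl, rfl⟩
  simp only [dif_pos hex]
  obtain ⟨-, hy2, hy3⟩ := hex.choose_spec
  -- For points of equal norm, reflection in the hyperplane orthogonal to their difference exchanges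
  -- them; that difference is orthogonal to `ξ`, hence to `m`.
  have h1 := h (x - hex.choose) (by
    rw [hc, inner_smul_left, inner_sub_right, real_inner_comm, real_inner_comm hex.choose, hy3,
      sub_self, mul_zero]) x hx
  rw [Submodule.reflection_sub hy2.symm] at h1
  exact h1.symm

end Symmetry


/-! ### Symmetry of constrained minimizers -/

section Minimizers

variable {N : ℕ} {Ω : Set (E N)} {f g : E N → ℝ → ℝ} {u : E N → ℝ} {U : E N → E N} {M κ : ℝ}

theorem exists_test_integral_ne_zero (hΩ : IsOpen Ω) (hne : Ω.Nonempty) {k : E N → ℝ}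
    (hk : MemLp k 2 (volume.restrict Ω)) (hk0 : ∀ᵐ x ∂volume.restrict Ω, k x ≠ 0) :
    ∃ ψ, IsTestFunction Ω ψ ∧ ∫ x in Ω, k x * ψ x ≠ 0 := by
  by_contra! hcon
  have := ae_neBot_of_isOpen hΩ hne
  have key := hΩ.ae_eq_zero_of_integral_contDiff_smul_eq_zero (μ := volume) (f := k)
    (locallyIntegrableOn_of_locallyIntegrable_restrict (hk.locallyIntegrable (by norm_num)))
    fun φ a b c => by
      have hφ : IsTestFunction Ω φ := ⟨a, b, c⟩
      rw [← setIntegral_eq_integral_of_tsupport (Ω := Ω) (fun x hx => by simp [hφ.eq_zero hx]),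
        ← hcon φ hφ]
      simp_rw [smul_eq_mul, mul_comm (φ _)]
  rw [← ae_restrict_iff' hΩ.measurableSet] at key
  obtain ⟨x, hx, hx'⟩ := (key.and hk0).exists
  exact hx' hx

theorem SolvesWithMultiplier.eq (hΩ : IsOpen Ω) (hne : Ω.Nonempty)
    (hg0 : ∀ᵐ x ∂volume.restrict Ω, g x (u x) ≠ 0) {lam lam' : ℝ}
    (h : SolvesWithMultiplier Ω f g u lam) (h' : SolvesWithMultiplier Ω f g u lam') :
    lam = lam' := by
  have := ae_neBot_of_isOpen hΩ hne
  obtain ⟨x, h1, h2, h3⟩ := (Filter.Eventually.and h (Filter.Eventually.and h' hg0)).exists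
  exact mul_right_cancel₀ h3 (by linarith)

/-- The set `S` serves both convexity assumptions: chords are only drawn to the right of values of
`u`, so convexity on a set containing every `Ici (u x)` is enough. -/
theorem isAxiallySymmetric_of_minimizer (hN : 2 ≤ N) (hΩ : IsBallOrAnnulus Ω)
    (hu : SobolevPair Ω u U) (huc : ContinuousOn u Ω) (hf : IsLocallyControlled Ω f)
    (hg : IsLocallyControlled Ω g) (hfr : IsRadial Ω f) (hgr : IsRadial Ω g) {lam : ℝ} (hM : 0 < M)
    (hb : ∀ x ∈ Ω, |u x| ≤ M)
    (hweak : ∀ φ, IsTestFunction Ω φ → ∫ x in Ω, inner ℝ (U x) (gradient φ x) =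
      ∫ x in Ω, (f x (u x) + lam * g x (u x)) * φ x) {S : Set ℝ}
    (hS : ∀ x ∈ Ω, Ici (u x) ⊆ S)
    (hconv : ∀ᵐ x ∂volume.restrict Ω, StrictConvexOn ℝ S (fun t => f x t + lam * g x t))
    (hcon : ∫ x in Ω, primitive g x (u x) = 1)
    (hmin : ∀ w ∈ constraintSet Ω g, energy Ω f u ≤ energy Ω f w)
    (hκ : ∀ᵐ x ∂volume.restrict Ω, 0 < κ * g x (u x)) : IsAxiallySymmetric Ω u := by
  have hΩo := hΩ.isOpen
  have := isFiniteMeasure_restrict hΩ.isBounded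
  have hrad : IsRadial Ω (fun x t => f x t + lam * g x t) := fun t x hx y hy hxy => by
    simp only [hfr t x hx y hy hxy, hgr t x hx y hy hxy]
  obtain ⟨B, hB⟩ := isBounded_iff_forall_norm_le.1 hΩ.isBounded
  have hint : Integrable (fun x => u x • x) (volume.restrict Ω) := by
    refine Integrable.of_bound ((huc.smul continuousOn_id).aestronglyMeasurable
      hΩo.measurableSet) (M * B) ((ae_restrict_mem hΩo.measurableSet).mono fun x hx => ?_)
    rw [norm_smul]
    exact mul_le_mul (hb x hx) (hB x hx) (norm_nonneg _) hM.le
  refine isAxiallySymmetric_of_reflection hN (∫ x in Ω, u x • x) fun e he => ?_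
  have hσ := isReflection_reflection e
  have hΩσ := hΩ.map_mem_iff (ℝ ∙ e)ᗮ.reflection
  by_cases h1 : ∃ x ∈ Ω, x ∈ halfSpace e ∧ u ((ℝ ∙ e)ᗮ.reflection x) < u x
  · by_cases h2 : ∃ x ∈ Ω, x ∈ halfSpace (-e) ∧ u ((ℝ ∙ e)ᗮ.reflection x) < u x
    · exact (not_exists_lt_both_sides hΩo hσ hΩσ hu huc hf hg hrad hM hb hweak hS hconv hcon hmin
        hκ h1 h2).elim
    · push Not at h2
      exact comp_reflection_eq_of_one_sided hΩo hσ.neg hΩσ huc hint (by simpa using he) h2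
  · push Not at h1
    exact comp_reflection_eq_of_one_sided hΩo hσ hΩσ huc hint he h1

end Minimizers

end ConstrainedSymmetry

end

/-! ### The main theorem -/

theorem mainTheorem3 (N : ℕ) (hN : 2 ≤ N)
    (Ω : Set (ConstrainedSymmetry.E N)) (hΩ : ConstrainedSymmetry.IsBallOrAnnulus Ω)
    (f g : ConstrainedSymmetry.E N → ℝ → ℝ)
    (hf : ConstrainedSymmetry.IsCaratheodory Ω f)
    (hf_rad : ConstrainedSymmetry.IsRadial Ω f)
    (hf_growth : ConstrainedSymmetry.SubcriticalGrowth Ω f)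
    (hf_lip : ConstrainedSymmetry.LocLipschitzInSecond Ω f)
    (hg : ConstrainedSymmetry.IsCaratheodory Ω g)
    (hg_rad : ConstrainedSymmetry.IsRadial Ω g)
    (hg_growth : ConstrainedSymmetry.SubcriticalGrowth Ω g)
    (hg_lip : ConstrainedSymmetry.LocLipschitzInSecond Ω g)
    (u₀ : ConstrainedSymmetry.E N → ℝ)
    (hu_smooth : ContDiffOn ℝ 2 u₀ Ω) (hu_cont : ContinuousOn u₀ (closure Ω))
    (hu_mem : u₀ ∈ ConstrainedSymmetry.constraintSet Ω g)
    (hu_min : ∀ u ∈ ConstrainedSymmetry.constraintSet Ω g,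
      ConstrainedSymmetry.energy Ω f u₀ ≤ ConstrainedSymmetry.energy Ω f u)
    (hg_sign : (∀ᵐ x ∂volume.restrict Ω, 0 < g x (u₀ x)) ∨
      (∀ᵐ x ∂volume.restrict Ω, g x (u₀ x) < 0)) :
    (∃! lam : ℝ, ConstrainedSymmetry.SolvesWithMultiplier Ω f g u₀ lam) ∧
    ∀ lam : ℝ, ConstrainedSymmetry.SolvesWithMultiplier Ω f g u₀ lam →
      ((∀ᵐ x ∂volume.restrict Ω, StrictConvexOn ℝ univ (fun t => f x t + lam * g x t)) →
        ConstrainedSymmetry.IsAxiallySymmetric Ω u₀) ∧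
      ((∀ x ∈ Ω, 0 ≤ u₀ x) →
        (∀ᵐ x ∂volume.restrict Ω, StrictConvexOn ℝ (Ici 0) (fun t => f x t + lam * g x t)) →
        ConstrainedSymmetry.IsAxiallySymmetric Ω u₀) := by
  have hΩo := hΩ.isOpen
  have hne := hΩ.nonempty hN
  have := ConstrainedSymmetry.isFiniteMeasure_restrict hΩ.isBounded
  have hfc := ConstrainedSymmetry.isLocallyControlled_of_growth hf hf_growth hf_lip
  have hgc := ConstrainedSymmetry.isLocallyControlled_of_growth hg hg_growth hg_lip
  obtain ⟨M, hM, hb⟩ :=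
    ConstrainedSymmetry.exists_abs_le_of_continuousOn_closure hΩ.isBounded hu_cont
  have huc : ContinuousOn u₀ Ω := hu_cont.mono subset_closure
  have hbu := ConstrainedSymmetry.isBoundedOn_of_continuousOn hΩo huc hb
  obtain ⟨hu_H, hcon⟩ := hu_mem
  obtain ⟨U, hu⟩ := hu_H.exists_pair
  -- A sign `κ = ±1` merges the two cases.
  obtain ⟨κ, hκ⟩ : ∃ κ : ℝ, ∀ᵐ x ∂volume.restrict Ω, 0 < κ * g x (u₀ x) := by
    rcases hg_sign with h | h
    · exact ⟨1, by simpa using h⟩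
    · exact ⟨-1, by simpa using h⟩
  have hg0 : ∀ᵐ x ∂volume.restrict Ω, g x (u₀ x) ≠ 0 :=
    hκ.mono fun x hx => right_ne_zero_of_mul hx.ne'
  obtain ⟨lam₀, hweak⟩ := ConstrainedSymmetry.exists_multiplier hΩo hu hfc hgc hM hbu hcon hu_min
    (ConstrainedSymmetry.exists_test_integral_ne_zero hΩo hne (hgc.memLp_comp hM hbu) hg0)
  have hsol := ConstrainedSymmetry.solvesWithMultiplier_of_weak hΩo hu_smooth hu
    ((hfc.add_const_mul hgc lam₀).memLp_comp hM hbu) hweak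
  refine ⟨⟨lam₀, hsol, fun lam hlam => hlam.eq hΩo hne hg0 hsol⟩, fun lam hlam => ?_⟩
  obtain rfl : lam = lam₀ := hlam.eq hΩo hne hg0 hsol
  refine ⟨fun hconv => ?_, fun hu0 hconv => ?_⟩
  · exact ConstrainedSymmetry.isAxiallySymmetric_of_minimizer hN hΩ hu huc hfc hgc hf_rad hg_rad
      hM hb hweak (fun x _ => subset_univ _) hconv hcon hu_min hκ
  · exact ConstrainedSymmetry.isAxiallySymmetric_of_minimizer hN hΩ hu huc hfc hgc hf_rad hg_rad
      hM hb hweak (fun x hx => Ici_subset_Ici.2 (hu0 x hx)) hconv hcon hu_min hκ
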